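/- **Setting.** Let $V=\coprod_{n\in\mathbb Z}V_{(n)}$ be a grading-restricted vertex algebra over $\mathbb C$ (finite-dimensional $V_{(n)}$, zero for $n\ll 0$; vertex operator map $Y_V$, vacuum $\mathbf 1\in V_{(0)}$; lower truncation, identity and creation properties, Jacobi identity, $L_V(0)$-bracket formula, $L_V(-1)$-derivative property, where $L_V(0)v=nv$ on $V_{(n)}$ and $L_V(-1)v=v_{-2}\mathbf 1$). A *lower-bounded generalized $V$-module* is a space $W$ with a vertex operator map $Y_W:V\otimes W\to W((x))$ and operators $L_W(0),L_W(-1)$ such that $W$ is the direct sum of the generalized eigenspaces $W_{[\mu]}$ of $L_W(0)$, the real parts of the eigenvalues are bounded below, $Y_W(\mathbf 1,x)=1_W$, the Jacobi identity holds, $[L_W(0),Y_W(v,x)]=x\frac{d}{dx}Y_W(v,x)+Y_W(L_V(0)v,x)$, $[L_W(-1),Y_W(v,x)]=Y_W(L_V(-1)v,x)=\frac{d}{dx}Y_W(v,x)$ and $[L_W(0),L_W(-1)]=L_W(-1)$. Submodules are subspaces invariant under all modes $v_n$ and under $L_W(0),L_W(-1)$. A module is *irreducible* if it is nonzero and has no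 submodules other than $0$ and itself, and *completely reducible* if it is a direct sum of irreducible submodules. **$Gr(W)$.** For $n\in\mathbb N$ let $\Omega_n(W)$ be the set of $w\in W$ with $v_kw=0$ for all homogeneous $v\in V$ and $k\in\mathbb Z$ with $\mathrm{wt}\,v-k-1<-n$; put $\Omega_{-1}(W)=0$, $Gr_n(W)=\Omega_n(W)/\Omega_{n-1}(W)$, $Gr(W)=\coprod_{n\in\mathbb N}Gr_n(W)$ and $Gr^N(W)=\coprod_{n=0}^NGr_n(W)$ for $N\in\mathbb N$. **$A^N(V)$.** Let $U^\infty(V)$ be the space of column-finite matrices $[v_{kl}]_{k,l\in\mathbb N}$ with entries in $V$, $[v]_{kl}$ the matrix with single nonzero entry $v$ at $(k,l)$, and $U^N(V)$ the subspace of matrices whose $(k,l)$-entries vanish unless $k,l\le N$. The product $\diamond$ on $U^\infty(V)$ is $$(\mathfrak u\diamond\mathfrak v)_{kl}=\sum_{n\in\mathbb N}\sum_{m=0}^{n}\binom{-k+n-l-1}{m}\mathrm{Res}_x\,x^{-k+n-l-m-1}(1+x)^l\,Y_V((1+x)^{L_V(0)}u_{kn},x)v_{nl}.$$ $U^\infty(V)$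 acts on $Gr(W)$ by the maps $\vartheta_{Gr(W)}([v]_{kl}):Gr_l(W)\to Gr_k(W)$ induced by $\mathrm{Res}_x\,x^{l-k-1}Y_W(x^{L_V(0)}v,x)$ (and $0$ on $Gr_n(W)$, $n\ne l$). Let $Q^\infty(V)$ be the intersection of the kernels of $\vartheta_{Gr(W)}$ over all lower-bounded generalized $V$-modules $W$, $A^\infty(V)=U^\infty(V)/Q^\infty(V)$, and $A^N(V)$ the image of $U^N(V)$ in $A^\infty(V)$, with the product induced by $\diamond$ and identity induced by $\mathbf 1^N=\sum_{k=0}^N[\mathbf 1]_{kk}$. **Graded $A^N(V)$-modules.** A *graded $A^N(V)$-module* is a (unital) $A^N(V)$-module $M=\coprod_{n=0}^NG_n(M)$, with action $\vartheta_M$, an operator $L_M(0)$ on $M$ and linear maps $L_M(-1):G_n(M)\to G_{n+1}(M)$ for $0\le n<N$, such that: (1) $\vartheta_M([v]_{kl})$ maps $G_l(M)$ to $G_k(M)$ and is $0$ on $G_n(M)$ for $n\neq l$; (2) if $w\in G_l(M)$ and $\vartheta_M([v]_{0l})w=0$ for all $v\in V$, then $w=0$; (3) $M$ is the direct sum of the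 generalized eigenspaces of $L_M(0)$ and the real parts of the eigenvalues are bounded below; (4) $[L_M(0),L_M(-1)]=L_M(-1)$ and $[L_M(0),\vartheta_M([v]_{kl})]=(k-l)\vartheta_M([v]_{kl})$; (5) for $0\le k,l\le N-1$, on $G_l(M)$, $L_M(-1)\vartheta_M([v]_{kl})-\vartheta_M([v]_{(k+1)(l+1)})L_M(-1)=\vartheta_M([L_V(-1)v]_{(k+1)l})$. Graded submodules are graded subspaces invariant under $A^N(V)$, $L_M(0)$ and $L_M(-1)$; *irreducible* and *completely reducible* are defined as above with graded submodules; an *equivalence* is an $A^N(V)$-linear isomorphism preserving the grading and commuting with $L(0)$ and $L(-1)$. **$T_N(W)$.** Let $W=\coprod_{\mu\in\mathcal M}W^\mu$ with $W^\mu$ irreducible (one summand if $W$ is irreducible), and let $h^\mu$ be the lowest weight of $W^\mu$, i.e. $W^\mu=\coprod_{n\in\mathbb N}W^\mu_{[h^\mu+n]}$ with $W^\mu_{[h^\mu]}\ne0$. Put $G_n(W)=\coprod_{\mu}W^\mu_{[h^\mu+n]}$ and $T_N(W)=\coprod_{n=0}^NG_n(W)$, on which $[v]_{kl}$ ($k,l\le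 N$) acts by $\mathrm{Res}_x\,x^{l-k-1}Y_W(x^{L_V(0)}v,x)$ on $G_l(W)$ and by $0$ on $G_n(W)$, $n\neq l$, with $L(0)$ and $L(-1)$ (on $G_n(W)$, $n<N$) given by $L_W(0)$ and $L_W(-1)$. **Proposition.** Let $W$ be a lower-bounded generalized $V$-module and $N\in\mathbb N$. If $W$ is irreducible (resp. completely reducible), then, for every decomposition of $W$ as above, $W=\coprod_{n\in\mathbb N}G_n(W)$; $Gr^N(W)$ (with the operators induced by $L_W(0)$, $L_W(-1)$) and $T_N(W)$ are graded $A^N(V)$-modules and are equivalent as such; and the graded $A^N(V)$-module $Gr^N(W)$ is irreducible (resp. completely reducible). -/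

import Mathlib

open scoped DirectSum

universe u

noncomputable section

/-- The `n`-th mode `v_n`, i.e. the coefficient of `x ^ (-n-1)` in `Y(v, x)`. -/
abbrev vmode {V W : Type*} [AddCommGroup V] [Module ℂ V] [AddCommGroup W] [Module ℂ W]
    (Y : V →ₗ[ℂ] VertexOperator ℂ W) (v : V) (n : ℤ) : Module.End ℂ W :=
  VertexOperator.ncoeff (Y v) n

/-- The Jacobi identity for a vertex operator map `YW` on `W`, written in components
(Borcherds' identity).  All the sums are finite because `Y(v, x) w` is a Laurent series. -/
def JacobiIdentity {V W : Type*} [AddCommGroup V] [Module ℂ V] [AddCommGroup W] [Module ℂ W]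
    (YV : V →ₗ[ℂ] VertexOperator ℂ V) (YW : V →ₗ[ℂ] VertexOperator ℂ W) : Prop :=
  ∀ (u v : V) (w : W) (m n p : ℤ),
    ∑ᶠ i : ℕ, Ring.choose m i • vmode YW (vmode YV u (p + i) v) (m + n - i) w =
      ∑ᶠ i : ℕ, ((-1 : ℤ) ^ i * Ring.choose p i) •
        (vmode YW u (m + p - i) (vmode YW v (n + i) w) -
          ((-1 : ℂ) ^ p) • vmode YW v (n + p - i) (vmode YW u (m + i) w))

/-! ### Column-finite matrices with entries in `V` -/

section Matrices

variable (V : Type u) [AddCommGroup V] [Module ℂ V]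

/-- `U^∞(V)`: column-finite matrices indexed by `ℕ × ℕ` with entries in `V`, stored by columns:
the `(k, l)` entry of `𝔲` is `𝔲 l k`. -/
abbrev UInf : Type u := ℕ → (ℕ →₀ V)

variable {V}

/-- The matrix `[v]_{kl}` with `(k, l)` entry `v` and all other entries `0`. -/
def elem (k l : ℕ) (v : V) : UInf V := Pi.single l (Finsupp.single k v)

variable (V)

/-- `U^N(V)`: the matrices whose `(k, l)` entries vanish unless `k, l ≤ N`. -/
def UN (N : ℕ) : Submodule ℂ (UInf V) where
  carrier := {a | ∀ k l : ℕ, (N < k ∨ N < l) → a l k = 0}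
  add_mem' := by
    intro a b ha hb k l h
    simp [ha k l h, hb k l h]
  zero_mem' := by intro k l _; simp
  smul_mem' := by
    intro c a ha k l h
    simp [ha k l h]

variable {V}

theorem elem_mem {N k l : ℕ} (hk : k ≤ N) (hl : l ≤ N) (v : V) : elem k l v ∈ UN V N := by
  intro k' l' h
  by_cases h1 : l' = l
  · subst h1
    have : k ≠ k' := by omega
    simp [elem, this]
  · simp [elem, h1]

/-- `[v]_{kl}` as an element of `U^N(V)`, for `k, l ≤ N`. -/
def elemN {N k l : ℕ} (hk : k ≤ N) (hl : l ≤ N) (v : V) : UN V N := ⟨elem k l v, elem_mem hk hl v⟩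

end Matrices

/-- A grading-restricted vertex algebra: a `ℤ`-graded space with finite-dimensional homogeneous
subspaces vanishing in sufficiently negative weights, a vertex operator map and a vacuum,
satisfying lower truncation (built into `VertexOperator`), the identity and creation properties,
the Jacobi identity, the `L(0)`-bracket formula (in the form: `v_n` has weight `wt v - n - 1`) and
the `L(-1)`-derivative property, where `L(-1) v = v_{-2} 1`. -/
class GradingRestrictedVertexAlgebra (V : Type u) [AddCommGroup V] [Module ℂ V] where
  /-- the homogeneous subspace of weight `n` -/
  wt : ℤ → Submodule ℂ V
  isInternal : DirectSum.IsInternal wt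
  finite_wt : ∀ n, FiniteDimensional ℂ (wt n)
  bounded_wt : ∃ B : ℤ, ∀ n < B, wt n = ⊥
  /-- the vertex operator map -/
  Y : V →ₗ[ℂ] VertexOperator ℂ V
  /-- the vacuum -/
  vac : V
  vac_mem : vac ∈ wt 0
  identity : ∀ n : ℤ, vmode Y vac n = if n = -1 then 1 else 0
  creation : ∀ v : V, vmode Y v (-1) vac = v
  creation_regular : ∀ (v : V) (n : ℤ), 0 ≤ n → vmode Y v n vac = 0
  jacobi : JacobiIdentity Y Y
  mode_mem : ∀ (d e n : ℤ) (u v : V), u ∈ wt d → v ∈ wt e → vmode Y u n v ∈ wt (d + e - n - 1)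
  derivative : ∀ (v : V) (n : ℤ),
    vmode Y (vmode Y v (-2) vac) n = (-n : ℤ) • vmode Y v (n - 1)
  derivative_bracket : ∀ (u v : V) (n : ℤ),
    vmode Y (vmode Y u n v) (-2) vac - vmode Y u n (vmode Y v (-2) vac) =
      vmode Y (vmode Y u (-2) vac) n v

namespace GradingRestrictedVertexAlgebra

variable (V : Type u) [AddCommGroup V] [Module ℂ V] [GradingRestrictedVertexAlgebra V]

theorem bijective_wt : Function.Bijective (DirectSum.coeLinearMap (wt (V := V))) := isInternal

/-- The linear map on `V = ⨁ V_(d)` given by `f d` on `V_(d)`. -/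
def wtLift {X : Type*} [AddCommGroup X] [Module ℂ X] (f : ℤ → V →ₗ[ℂ] X) : V →ₗ[ℂ] X :=
  (DirectSum.toModule ℂ ℤ X fun d => f d ∘ₗ (wt (V := V) d).subtype) ∘ₗ
    (LinearEquiv.ofBijective (DirectSum.coeLinearMap (wt (V := V))) (bijective_wt V)).symm.toLinearMap

theorem wtLift_of_mem {X : Type*} [AddCommGroup X] [Module ℂ X] (f : ℤ → V →ₗ[ℂ] X) {d : ℤ}
    {v : V} (hv : v ∈ wt (V := V) d) : wtLift V f v = f d v := by
  have h : (LinearEquiv.ofBijective (DirectSum.coeLinearMap (wt (V := V))) (bijective_wt V)).symm v =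
      DirectSum.lof ℂ ℤ (fun d => wt (V := V) d) d ⟨v, hv⟩ := by
    rw [LinearEquiv.symm_apply_eq]
    simp [DirectSum.coeLinearMap_lof]
  simp [wtLift, h]

/-- The projection of `V` onto `V_(d)`. -/
def wtProj (d : ℤ) : V →ₗ[ℂ] V := wtLift V fun e => if e = d then LinearMap.id else 0

/-- `L_V(0)`, which is multiplication by `d` on `V_(d)`. -/
def LZero : Module.End ℂ V := wtLift V fun d => (d : ℂ) • LinearMap.id

/-- `L_V(-1) v = v_{-2} 1`. -/
def LNegOne (v : V) : V := vmode (Y (V := V)) v (-2) (vac (V := V))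

/-! ### The product `⋄` -/

variable {V}

/-- `Res_x x^e (1+x)^l Y_V((1+x)^{L_V(0)} u, x) v`; for `u` of weight `d` this is
`∑_j binom(l+d, j) u_{e+j} v`. -/
def resY (e l : ℤ) (u v : V) : V :=
  ∑ᶠ d : ℤ, ∑ᶠ j : ℕ, Ring.choose (l + d) j • vmode (Y (V := V)) (wtProj V d u) (e + j) v

/-- The entry `Res_x T_{k+l+1}((x+1)^{-k+n-l-1}) (1+x)^l Y_V((1+x)^{L_V(0)} u, x) v`
of `[u]_{kn} ⋄ [v]_{nl}`. -/
def diamondEntry (k n l : ℕ) (u v : V) : V :=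
  ∑ m ∈ Finset.range (n + 1), Ring.choose (-(k : ℤ) + n - l - 1) m •
    resY (-(k : ℤ) + n - l - m - 1) l u v

/-- The product `⋄` on `U^∞(V)`: `(𝔲 ⋄ 𝔳)_{kl} = ∑_n diamondEntry k n l 𝔲_{kn} 𝔳_{nl}`. -/
def diamond (a b : UInf V) : UInf V := fun l =>
  (b l).sum fun n v => (a n).sum fun k u => Finsupp.single k (diamondEntry k n l u v)

theorem diamond_mem {N : ℕ} {a b : UInf V} (ha : a ∈ UN V N) (hb : b ∈ UN V N) :
    diamond a b ∈ UN V N := by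
  intro k l h
  simp only [diamond, Finsupp.sum, Finsupp.finsetSum_apply]
  refine Finset.sum_eq_zero fun n hn => Finset.sum_eq_zero fun k' hk' => ?_
  rcases h with h | h
  · have : k' ≠ k := by
      rintro rfl
      exact (Finsupp.mem_support_iff.1 hk') (ha _ _ (Or.inl h))
    simp [this]
  · exact absurd (hb _ _ (Or.inr h)) (Finsupp.mem_support_iff.1 hn)

/-- The product `⋄` on `U^N(V)`. -/
def diamondN {N : ℕ} (a b : UN V N) : UN V N := ⟨diamond a.1 b.1, diamond_mem a.2 b.2⟩

variable (V)

/-- `1^N = ∑_{k ≤ N} [1]_{kk}`. -/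
def oneN (N : ℕ) : UN V N :=
  ∑ k : Fin (N + 1), elemN (Nat.lt_succ_iff.1 k.2) (Nat.lt_succ_iff.1 k.2) (vac (V := V))

end GradingRestrictedVertexAlgebra

open GradingRestrictedVertexAlgebra

/-! ### Lower-bounded generalized modules -/

/-- The structure of a lower-bounded generalized `V`-module on `W`.  The homogeneous subspace
`W_[μ]` is the generalized eigenspace of `L_W(0)` with eigenvalue `μ`; generalized eigenspaces
are always independent, so `W` is their direct sum as soon as they span. -/
structure LBGModule (V : Type u) [AddCommGroup V] [Module ℂ V] [GradingRestrictedVertexAlgebra V]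
    (W : Type u) [AddCommGroup W] [Module ℂ W] where
  /-- the vertex operator map -/
  Y : V →ₗ[ℂ] VertexOperator ℂ W
  /-- the operator `L_W(0)` -/
  L0 : Module.End ℂ W
  /-- the operator `L_W(-1)` -/
  Lm1 : Module.End ℂ W
  graded : ⨆ μ : ℂ, L0.maxGenEigenspace μ = ⊤
  bounded : ∃ B : ℝ, ∀ μ : ℂ, μ.re < B → L0.maxGenEigenspace μ = ⊥
  identity : ∀ n : ℤ, vmode Y vac n = if n = -1 then 1 else 0
  jacobi : JacobiIdentity (GradingRestrictedVertexAlgebra.Y (V := V)) Y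
  L0_bracket : ∀ (v : V) (n : ℤ),
    L0 * vmode Y v n - vmode Y v n * L0 = vmode Y (LZero V v) n - ((n : ℂ) + 1) • vmode Y v n
  Lm1_derivative : ∀ (v : V) (n : ℤ), vmode Y (LNegOne V v) n = (-n : ℤ) • vmode Y v (n - 1)
  Lm1_bracket : ∀ (v : V) (n : ℤ),
    Lm1 * vmode Y v n - vmode Y v n * Lm1 = vmode Y (LNegOne V v) n
  L0_Lm1 : L0 * Lm1 - Lm1 * L0 = Lm1

/-! ### Graded spaces with a matrix action, and their truncations -/

section System

variable {V : Type u} [AddCommGroup V] [Module ℂ V]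
variable {G : ℕ → Type u} [∀ n, AddCommGroup (G n)] [∀ n, Module ℂ (G n)]

/-- Given linear maps `act k l v : G l → G k`, the operator on `⨁ n, G n` attached to a
column-finite matrix `𝔳` with entries in `V`: `𝔤 ↦ ∑_{k,l} act k l 𝔳_{kl} (π_l 𝔤)`. -/
def matAct (act : ∀ k l : ℕ, V →ₗ[ℂ] G l →ₗ[ℂ] G k) :
    UInf V →ₗ[ℂ] Module.End ℂ (⨁ n, G n) where
  toFun a := DirectSum.toModule ℂ ℕ _ fun l =>
    (a l).sum fun k v => DirectSum.lof ℂ ℕ G k ∘ₗ act k l v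
  map_add' a b := by
    refine DirectSum.linearMap_ext _ fun l => LinearMap.ext fun x => ?_
    simp only [LinearMap.comp_apply, DirectSum.toModule_lof, LinearMap.add_apply, Pi.add_apply]
    rw [Finsupp.sum_add_index' (by intro k; simp) (by intro k v w; simp [LinearMap.comp_add])]
    rfl
  map_smul' c a := by
    refine DirectSum.linearMap_ext _ fun l => LinearMap.ext fun x => ?_
    simp only [LinearMap.comp_apply, DirectSum.toModule_lof, LinearMap.smul_apply, Pi.smul_apply,
      RingHom.id_apply]
    rw [Finsupp.sum_smul_index' (by intro k; simp), Finsupp.sum, Finsupp.sum,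
      LinearMap.sum_apply, LinearMap.sum_apply, Finset.smul_sum]
    simp

/-- A degree-preserving operator on `⨁ n, G n`. -/
def degZero (f : ∀ n, Module.End ℂ (G n)) : Module.End ℂ (⨁ n, G n) :=
  DirectSum.toModule ℂ ℕ _ fun n => DirectSum.lof ℂ ℕ G n ∘ₗ f n

/-- An operator on `⨁ n, G n` mapping `G n` to `G (n+1)` for `n < N` and `G n` to `0` for
`n ≥ N`. -/
def degOne (N : ℕ) (f : ∀ n, G n →ₗ[ℂ] G (n + 1)) : Module.End ℂ (⨁ n, G n) :=
  DirectSum.toModule ℂ ℕ _ fun n =>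
    if n < N then DirectSum.lof ℂ ℕ G (n + 1) ∘ₗ f n else 0

variable (G) in
/-- The subspace `⨁_{n ≤ N} G n` of `⨁ n, G n`. -/
def upTo (N : ℕ) : Submodule ℂ (⨁ n, G n) :=
  ⨆ n : Fin (N + 1), LinearMap.range (DirectSum.lof ℂ ℕ G n)

theorem lof_mem_upTo {N n : ℕ} (h : n ≤ N) (x : G n) : DirectSum.lof ℂ ℕ G n x ∈ upTo G N :=
  (le_iSup (fun n : Fin (N + 1) => LinearMap.range (DirectSum.lof ℂ ℕ G n))
    ⟨n, Nat.lt_succ_of_le h⟩) ⟨x, rfl⟩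

theorem map_mem_upTo {N : ℕ} (f : Module.End ℂ (⨁ n, G n))
    (h : ∀ n ≤ N, ∀ x : G n, f (DirectSum.lof ℂ ℕ G n x) ∈ upTo G N) :
    ∀ x ∈ upTo G N, f x ∈ upTo G N := by
  suffices upTo G N ≤ (upTo G N).comap f from this
  refine iSup_le fun n => ?_
  rintro _ ⟨x, rfl⟩
  exact h n (Nat.lt_succ_iff.1 n.2) x

theorem degZero_mem_upTo (N : ℕ) (f : ∀ n, Module.End ℂ (G n)) :
    ∀ x ∈ upTo G N, degZero f x ∈ upTo G N :=
  map_mem_upTo _ fun n hn x => by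
    simpa [degZero] using lof_mem_upTo hn (f n x)

theorem degOne_mem_upTo (N : ℕ) (f : ∀ n, G n →ₗ[ℂ] G (n + 1)) :
    ∀ x ∈ upTo G N, degOne N f x ∈ upTo G N :=
  map_mem_upTo _ fun n _ x => by
    by_cases h : n < N
    · simpa [degOne, h] using lof_mem_upTo (Nat.succ_le_of_lt h) (f n x)
    · simp [degOne, h]

end System

section ANModules

variable {V : Type u} [AddCommGroup V] [Module ℂ V]
variable {G : ℕ → Type u} [∀ n, AddCommGroup (G n)] [∀ n, Module ℂ (G n)]

theorem matAct_mem_upTo (act : ∀ k l : ℕ, V →ₗ[ℂ] G l →ₗ[ℂ] G k) {N : ℕ} {a : UInf V}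
    (ha : a ∈ UN V N) : ∀ x ∈ upTo G N, matAct act a x ∈ upTo G N :=
  map_mem_upTo _ fun l _ x => by
    simp only [matAct, LinearMap.coe_mk, AddHom.coe_mk, DirectSum.toModule_lof, Finsupp.sum,
      LinearMap.sum_apply, LinearMap.comp_apply]
    refine Submodule.sum_mem _ fun k hk => lof_mem_upTo ?_ _
    by_contra hlt
    exact (Finsupp.mem_support_iff.1 hk) (ha k l (Or.inl (not_le.1 hlt)))

variable (V) in
/-- The data of an `ℕ`-graded space concentrated in degrees `0, …, N` with an action of the
matrix space `U^N(V)` and operators `L(0)`, `L(-1)`.  The operator `L(-1)` is only meaningful on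
degrees `0, …, N - 1`; it is stored as an operator on all of `M` that is `0` on degree `N`. -/
structure GradedData (N : ℕ) (M : Type*) [AddCommGroup M] [Module ℂ M] where
  /-- the action of `U^N(V)` -/
  theta : UN V N →ₗ[ℂ] Module.End ℂ M
  /-- the homogeneous subspaces -/
  gr : ℕ → Submodule ℂ M
  /-- the operator `L_M(0)` -/
  L0 : Module.End ℂ M
  /-- the operator `L_M(-1)`, extended by `0` to degree `N` -/
  Lm1 : Module.End ℂ M

/-- The data on `⨁_{n ≤ N} G n` obtained by restriction from a system of maps
`act k l v : G l → G k`, `L0 n : G n → G n` and `Lm1 n : G n → G (n+1)`. -/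
def truncData (N : ℕ) (act : ∀ k l : ℕ, V →ₗ[ℂ] G l →ₗ[ℂ] G k) (L0 : ∀ n, Module.End ℂ (G n))
    (Lm1 : ∀ n, G n →ₗ[ℂ] G (n + 1)) : GradedData V N (upTo G N) where
  theta :=
    { toFun := fun a => (matAct act a.1).restrict (matAct_mem_upTo act a.2)
      map_add' := fun a b => by ext x; simp
      map_smul' := fun c a => by ext x; simp }
  gr n := (LinearMap.range (DirectSum.lof ℂ ℕ G n)).comap (upTo G N).subtype
  L0 := (degZero L0).restrict (degZero_mem_upTo N L0)
  Lm1 := (degOne N Lm1).restrict (degOne_mem_upTo N Lm1)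

end ANModules

namespace LBGModule

variable {V : Type u} [AddCommGroup V] [Module ℂ V] [GradingRestrictedVertexAlgebra V]
variable {W : Type u} [AddCommGroup W] [Module ℂ W] (S : LBGModule V W)

/-- `Res_x x^{-s-1} Y_W(x^{L_V(0)} v, x)`, the component of weight `s` of the vertex operator:
for `v` of weight `d` it is `v_{d-1-s}`. -/
def opShift (s : ℤ) : V →ₗ[ℂ] Module.End ℂ W :=
  wtLift V fun d => LinearMap.proj (d - 1 - s) ∘ₗ VertexOperator.ncoeff ∘ₗ S.Y

/-- `Ω_n(W)`: the vectors killed by all modes `v_k` of weight `wt v - k - 1 < -n`. -/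
def Omega (n : ℤ) : Submodule ℂ W where
  carrier := {w | ∀ (d k : ℤ) (v : V), v ∈ wt (V := V) d → d - k - 1 < -n → vmode S.Y v k w = 0}
  add_mem' := by
    intro a b ha hb d k v hv h
    rw [map_add, ha d k v hv h, hb d k v hv h, add_zero]
  zero_mem' := by intro d k v _ _; exact map_zero _
  smul_mem' := by
    intro c a ha d k v hv h
    rw [map_smul, ha d k v hv h, smul_zero]

/-- `Ω_{-1}(W) = 0`. -/
theorem Omega_neg_one : S.Omega (-1) = ⊥ := by
  refine (Submodule.eq_bot_iff _).2 fun w hw => ?_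
  have h := hw 0 (-1) vac vac_mem (by norm_num)
  rw [S.identity] at h
  simpa using h

theorem Omega_mono {m n : ℤ} (h : m ≤ n) : S.Omega m ≤ S.Omega n :=
  fun _ hw d k v hv hk => hw d k v hv (by omega)

theorem opShift_of_mem (s : ℤ) {d : ℤ} {v : V} (hv : v ∈ wt (V := V) d) :
    S.opShift s v = vmode S.Y v (d - 1 - s) := by
  rw [opShift, wtLift_of_mem V _ hv]
  rfl

theorem opShift_induction {s : ℤ} (p : Module.End ℂ W → Prop) (h0 : p 0)
    (hadd : ∀ f g, p f → p g → p (f + g))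
    (h : ∀ (d : ℤ) (v : V), v ∈ wt (V := V) d → p (vmode S.Y v (d - 1 - s))) (v : V) :
    p (S.opShift s v) := by
  have hv : v ∈ ⨆ d, wt (V := V) d := by
    rw [DirectSum.IsInternal.submodule_iSup_eq_top isInternal]
    trivial
  induction hv using Submodule.iSup_induction' with
  | mem d x hx => rw [S.opShift_of_mem s hx]; exact h d x hx
  | zero => rw [map_zero]; exact h0
  | add x y _ _ hx hy => rw [map_add]; exact hadd _ _ hx hy

/-- A product of modes of total weight `< -n` kills `Ω_n(W)`. -/
theorem mode_mode_eq_zero {n d e p q : ℤ} {u v : V} {w : W} (hw : w ∈ S.Omega n)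
    (hu : u ∈ wt (V := V) d) (hv : v ∈ wt (V := V) e)
    (h : (d - p - 1) + (e - q - 1) < -n) : vmode S.Y u p (vmode S.Y v q w) = 0 := by
  have key : ∀ (j : ℕ) (p q : ℤ), e + n - q ≤ j → (d - p - 1) + (e - q - 1) < -n →
      vmode S.Y u p (vmode S.Y v q w) = 0 := by
    intro j
    induction j with
    | zero =>
      intro p q hq _
      rw [hw e q v hv (by push_cast at hq; omega), map_zero]
    | succ j ih =>
      intro p q hq hpq
      have hB := S.jacobi u v w (d + n) q (p - (d + n))
      have hL : ∀ i : ℕ, Ring.choose (d + n) i •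
          vmode S.Y (vmode (GradingRestrictedVertexAlgebra.Y (V := V)) u (p - (d + n) + i) v)
            (d + n + q - i) w = 0 := by
        intro i
        rw [hw _ _ _ (mode_mem d e (p - (d + n) + i) u v hu hv) (by omega), smul_zero]
      have hR : ∀ i : ℕ, vmode S.Y u (d + n + i) w = 0 := fun i => hw d _ u hu (by omega)
      simp only [hL, hR, map_zero, smul_zero, sub_zero, finsum_zero] at hB
      rw [finsum_eq_single _ 0] at hB
      · simpa using hB.symm
      · intro i hi
        rw [ih _ _ (by push_cast at hq; omega) (by omega), smul_zero]
  exact key (e + n - q).toNat p q (by omega) h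

theorem opShift_mem_Omega (s : ℤ) (v : V) :
    ∀ (n : ℤ), ∀ w ∈ S.Omega n, S.opShift s v w ∈ S.Omega (n + s) := by
  intro n w hw
  refine S.opShift_induction (fun f => f w ∈ S.Omega (n + s)) (Submodule.zero_mem _)
    (fun f g hf hg => Submodule.add_mem _ hf hg) (fun e v hv => ?_) v
  intro d k u hu hk
  exact S.mode_mode_eq_zero hw hu hv (by omega)

theorem L0_mem_Omega : ∀ (n : ℤ), ∀ w ∈ S.Omega n, S.L0 w ∈ S.Omega (n + 0) := by
  intro n w hw d k v hv hk
  have h := congrArg (fun f => f w) (S.L0_bracket v k)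
  have h1 : LZero V v = (d : ℂ) • v := by rw [LZero, wtLift_of_mem V _ hv]; rfl
  have h2 := hw d k v hv (by omega)
  simp only [h1, LinearMap.sub_apply, Module.End.mul_apply, LinearMap.smul_apply, map_smul,
    Pi.smul_apply, h2, map_zero, smul_zero, sub_zero, zero_sub, neg_eq_zero, vmode] at h
  exact h

theorem Lm1_mem_Omega : ∀ (n : ℤ), ∀ w ∈ S.Omega n, S.Lm1 w ∈ S.Omega (n + 1) := by
  intro n w hw d k v hv hk
  have h := congrArg (fun f => f w) (S.Lm1_bracket v k)
  have h2 := hw d k v hv (by omega)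
  have h3 := hw d (k - 1) v hv (by omega)
  rw [S.Lm1_derivative] at h
  simpa [h2, h3] using h

/-- `Gr_n(W) = Ω_n(W) / Ω_{n-1}(W)`. -/
abbrev Gr (n : ℕ) : Type u := S.Omega n ⧸ (S.Omega ((n : ℤ) - 1)).submoduleOf (S.Omega n)

/-- The map `Gr_l(W) → Gr_k(W)` induced by an operator that maps `Ω_n(W)` to `Ω_{n+s}(W)`,
where `k = l + s`. -/
def grMap {s : ℤ} (f : Module.End ℂ W) (hf : ∀ (n : ℤ), ∀ w ∈ S.Omega n, f w ∈ S.Omega (n + s))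
    (k l : ℕ) (h : (k : ℤ) = l + s) : S.Gr l →ₗ[ℂ] S.Gr k :=
  Submodule.mapQ _ _ (f.restrict (p := S.Omega l) (q := S.Omega k) (h ▸ hf l)) fun w hw => by
    have h1 := hf _ _ (show (w : W) ∈ S.Omega ((l : ℤ) - 1) from hw)
    rw [show (l : ℤ) - 1 + s = (k : ℤ) - 1 by omega] at h1
    exact h1

/-- The map `Gr_l(W) → Gr_k(W)` induced by `Res_x x^{l-k-1} Y_W(x^{L_V(0)} v, x)`. -/
def grAct (k l : ℕ) : V →ₗ[ℂ] S.Gr l →ₗ[ℂ] S.Gr k where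
  toFun v := S.grMap (S.opShift ((k : ℤ) - l) v) (S.opShift_mem_Omega _ v) k l (by omega)
  map_add' a b := by
    refine Submodule.linearMap_qext _ (LinearMap.ext fun w => ?_)
    simp only [grMap, map_add]
    rfl
  map_smul' c a := by
    refine Submodule.linearMap_qext _ (LinearMap.ext fun w => ?_)
    simp only [grMap, map_smul]
    rfl

/-- The operator on `Gr_n(W)` induced by `L_W(0)`. -/
def grL0 (n : ℕ) : Module.End ℂ (S.Gr n) := S.grMap S.L0 S.L0_mem_Omega n n (by omega)

/-- The map `Gr_n(W) → Gr_{n+1}(W)` induced by `L_W(-1)`. -/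
def grLm1 (n : ℕ) : S.Gr n →ₗ[ℂ] S.Gr (n + 1) :=
  S.grMap S.Lm1 S.Lm1_mem_Omega (n + 1) n (by push_cast; ring)

/-- `ϑ_{Gr(W)} : U^∞(V) → End Gr(W)`, where `Gr(W) = ⨁ n, Gr_n(W)`. -/
def theta : UInf V →ₗ[ℂ] Module.End ℂ (⨁ n, S.Gr n) := matAct S.grAct

/-- `Gr^N(W) = ⨁_{n ≤ N} Gr_n(W)` with its grading, its `U^N(V)`-action and the operators
induced by `L_W(0)` and `L_W(-1)`. -/
def GrN (N : ℕ) : GradedData V N (upTo S.Gr N) := truncData N S.grAct S.grL0 S.grLm1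

/-! #### Submodules, irreducibility, complete reducibility -/

/-- Generalized `V`-submodules. -/
structure IsSubmodule (P : Submodule ℂ W) : Prop where
  mode_mem : ∀ (v : V) (n : ℤ), ∀ w ∈ P, vmode S.Y v n w ∈ P
  L0_mem : ∀ w ∈ P, S.L0 w ∈ P
  Lm1_mem : ∀ w ∈ P, S.Lm1 w ∈ P

/-- The generalized `V`-submodule `P` is an irreducible module: it is nonzero and has no
generalized `V`-submodules other than `0` and `P`. -/
def IsIrreducibleSub (P : Submodule ℂ W) : Prop :=
  S.IsSubmodule P ∧ P ≠ ⊥ ∧ ∀ P' ≤ P, S.IsSubmodule P' → P' = ⊥ ∨ P' = P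

/-- `W` is irreducible. -/
def IsIrreducible : Prop := S.IsIrreducibleSub ⊤

/-- `W` is the (internal) direct sum of the irreducible submodules in the set `𝔇`. -/
def IsDecomposition (𝔇 : Set (Submodule ℂ W)) : Prop :=
  (∀ P ∈ 𝔇, S.IsIrreducibleSub P) ∧ sSupIndep 𝔇 ∧ sSup 𝔇 = ⊤

/-- `W` is a direct sum of irreducible submodules. -/
def IsCompletelyReducible : Prop := ∃ 𝔇, S.IsDecomposition 𝔇

/-! #### The module `T_N(W)` -/

/-- `P` is a submodule of the form `⨁_{n ∈ ℕ} P_[h+n]` with `P_[h] ≠ 0`. -/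
def IsLowestWeight (P : Submodule ℂ W) (h : ℂ) : Prop :=
  S.IsSubmodule P ∧ P = ⨆ n : ℕ, P ⊓ S.L0.maxGenEigenspace (h + n) ∧
    P ⊓ S.L0.maxGenEigenspace h ≠ ⊥

/-- `G_n(W) = ⨁_{P ∈ 𝔇} P_[h_P + n]`, where `W` is the direct sum of the irreducible submodules
`P ∈ 𝔇` and `h_P` is the lowest weight of `P`. -/
def GSub (𝔇 : Set (Submodule ℂ W)) (n : ℕ) : Submodule ℂ W :=
  ⨆ (P ∈ 𝔇) (h : ℂ) (_ : S.IsLowestWeight P h), P ⊓ S.L0.maxGenEigenspace (h + n)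

theorem maxGen_shift {f : Module.End ℂ W} {s : ℂ} (hf : S.L0 * f - f * S.L0 = s • f) (μ : ℂ) :
    ∀ w ∈ S.L0.maxGenEigenspace μ, f w ∈ S.L0.maxGenEigenspace (μ + s) := by
  intro w hw
  rw [Module.End.mem_maxGenEigenspace] at hw ⊢
  obtain ⟨k, hk⟩ := hw
  have h1 : (S.L0 - (μ + s) • 1) * f = f * (S.L0 - μ • 1) := by
    rw [sub_mul, mul_sub, smul_mul_assoc, mul_smul_comm, one_mul, mul_one, add_smul, ← hf]
    abel
  have h2 : (S.L0 - (μ + s) • 1) ^ k * f = f * (S.L0 - μ • 1) ^ k := by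
    have h3 : SemiconjBy f (S.L0 - μ • 1) (S.L0 - (μ + s) • 1) := h1.symm
    exact (h3.pow_right k).symm
  refine ⟨k, ?_⟩
  have h4 := congrArg (fun g => g w) h2
  simpa [hk] using h4

theorem map_GSub {f : Module.End ℂ W} {s : ℂ} (hf : S.L0 * f - f * S.L0 = s • f)
    (hP : ∀ P, S.IsSubmodule P → ∀ w ∈ P, f w ∈ P) (𝔇 : Set (Submodule ℂ W)) {k l : ℕ}
    (h : (k : ℂ) = l + s) : ∀ w ∈ S.GSub 𝔇 l, f w ∈ S.GSub 𝔇 k := by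
  suffices S.GSub 𝔇 l ≤ (S.GSub 𝔇 k).comap f from this
  refine iSup₂_le fun P hP1 => iSup₂_le fun μ hμ => fun w hw => ?_
  have h1 : f w ∈ P ⊓ S.L0.maxGenEigenspace (μ + k) := by
    refine ⟨hP P hμ.1 w hw.1, ?_⟩
    rw [h, ← add_assoc]
    exact S.maxGen_shift hf _ w hw.2
  exact le_iSup₂_of_le (f := fun P (_ : P ∈ 𝔇) => ⨆ (h : ℂ) (_ : S.IsLowestWeight P h),
    P ⊓ S.L0.maxGenEigenspace (h + k)) P hP1 (le_iSup₂_of_le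
    (f := fun h (_ : S.IsLowestWeight P h) => P ⊓ S.L0.maxGenEigenspace (h + k)) μ hμ le_rfl) h1

theorem opShift_bracket (s : ℤ) (v : V) :
    S.L0 * S.opShift s v - S.opShift s v * S.L0 = (s : ℂ) • S.opShift s v := by
  refine S.opShift_induction (fun f => S.L0 * f - f * S.L0 = (s : ℂ) • f) (by simp)
    (fun f g hf hg => ?_) (fun d v hv => ?_) v
  · rw [smul_add, ← hf, ← hg, mul_add, add_mul]
    abel
  · have h1 : LZero V v = (d : ℂ) • v := by rw [LZero, wtLift_of_mem V _ hv]; rfl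
    rw [S.L0_bracket, h1]
    simp only [vmode, map_smul, Pi.smul_apply]
    rw [← sub_smul]
    congr 1
    push_cast
    ring

theorem opShift_mem_sub (s : ℤ) (v : V) (P : Submodule ℂ W) (hP : S.IsSubmodule P) :
    ∀ w ∈ P, S.opShift s v w ∈ P := fun w hw =>
  S.opShift_induction (fun f => f w ∈ P) (Submodule.zero_mem _)
    (fun _ _ hf hg => Submodule.add_mem _ hf hg) (fun _ v _ => hP.mode_mem v _ w hw) v

theorem opShift_mem_GSub (𝔇 : Set (Submodule ℂ W)) (k l : ℕ) (v : V) :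
    ∀ w ∈ S.GSub 𝔇 l, S.opShift ((k : ℤ) - l) v w ∈ S.GSub 𝔇 k :=
  S.map_GSub (S.opShift_bracket _ v) (S.opShift_mem_sub _ v) 𝔇 (by push_cast; ring)

theorem L0_mem_GSub (𝔇 : Set (Submodule ℂ W)) (n : ℕ) :
    ∀ w ∈ S.GSub 𝔇 n, S.L0 w ∈ S.GSub 𝔇 n :=
  S.map_GSub (s := 0) (by simp) (fun _ hP => hP.L0_mem) 𝔇 (by simp)

theorem Lm1_mem_GSub (𝔇 : Set (Submodule ℂ W)) (n : ℕ) :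
    ∀ w ∈ S.GSub 𝔇 n, S.Lm1 w ∈ S.GSub 𝔇 (n + 1) :=
  S.map_GSub (s := 1) (by simpa using S.L0_Lm1) (fun _ hP => hP.Lm1_mem) 𝔇 (by simp)

/-- The map `G_l(W) → G_k(W)` given by `Res_x x^{l-k-1} Y_W(x^{L_V(0)} v, x)`. -/
def GSubAct (𝔇 : Set (Submodule ℂ W)) (k l : ℕ) : V →ₗ[ℂ] S.GSub 𝔇 l →ₗ[ℂ] S.GSub 𝔇 k where
  toFun v := (S.opShift ((k : ℤ) - l) v).restrict (S.opShift_mem_GSub 𝔇 k l v)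
  map_add' a b := by ext w; simp
  map_smul' c a := by ext w; simp

/-- `T_N(W) = ⨁_{n ≤ N} G_n(W)`, with its grading, its `U^N(V)`-action and the operators given by
`L_W(0)` and `L_W(-1)`. -/
def TN (𝔇 : Set (Submodule ℂ W)) (N : ℕ) : GradedData V N (upTo (fun n => S.GSub 𝔇 n) N) :=
  truncData N (S.GSubAct 𝔇) (fun n => S.L0.restrict (S.L0_mem_GSub 𝔇 n))
    (fun n => S.Lm1.restrict (S.Lm1_mem_GSub 𝔇 n))

end LBGModule

/-! ### The algebras `A^∞(V)`, `A^N(V)` and graded `A^N(V)`-modules -/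

section GradedModules

variable (V : Type u) [AddCommGroup V] [Module ℂ V] [GradingRestrictedVertexAlgebra V]

/-- `Q^∞(V)`: the intersection of the kernels of `ϑ_{Gr(W)}` over all lower-bounded generalized
`V`-modules `W`. -/
def QInf : Submodule ℂ (UInf V) :=
  ⨅ (W : Type u) (_ : AddCommGroup W) (_ : Module ℂ W) (S : LBGModule V W), LinearMap.ker S.theta

/-- `A^∞(V) = U^∞(V) / Q^∞(V)`; its product is the one induced by `⋄`. -/
abbrev AInf : Type u := UInf V ⧸ QInf V

/-- `A^N(V)`: the image of `U^N(V)` in `A^∞(V)`. -/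
def AN (N : ℕ) : Submodule ℂ (AInf V) := (UN V N).map (QInf V).mkQ

/-- The projection `U^N(V) → A^N(V)`. -/
def toAN (N : ℕ) : UN V N →ₗ[ℂ] AN V N := (QInf V).mkQ.submoduleMap (UN V N)

variable {V}

namespace GradedData

variable {N : ℕ} {M : Type*} [AddCommGroup M] [Module ℂ M] (D : GradedData V N M)

/-- `M` is a graded `A^N(V)`-module.  Since the product and the unit of `A^N(V)` are induced by
`⋄` and `1^N` on `U^N(V)`, an `A^N(V)`-module structure is an action of `U^N(V)` that factors
through `A^N(V)`, is multiplicative for `⋄` and maps `1^N` to the identity. -/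
structure IsGradedModule : Prop where
  factors : ∃ θ : AN V N →ₗ[ℂ] Module.End ℂ M, ∀ a, D.theta a = θ (toAN V N a)
  map_diamond : ∀ a b, D.theta (diamondN a b) = D.theta a * D.theta b
  map_one : D.theta (oneN V N) = 1
  isInternal : DirectSum.IsInternal D.gr
  gr_eq_bot : ∀ n, N < n → D.gr n = ⊥
  elem_ne : ∀ (k l n : ℕ) (hk : k ≤ N) (hl : l ≤ N) (v : V), n ≠ l →
    ∀ w ∈ D.gr n, D.theta (elemN hk hl v) w = 0
  elem_mem : ∀ (k l : ℕ) (hk : k ≤ N) (hl : l ≤ N) (v : V),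
    ∀ w ∈ D.gr l, D.theta (elemN hk hl v) w ∈ D.gr k
  nondegenerate : ∀ (l : ℕ) (hl : l ≤ N), ∀ w ∈ D.gr l,
    (∀ v : V, D.theta (elemN (Nat.zero_le N) hl v) w = 0) → w = 0
  L0_graded : ⨆ μ : ℂ, D.L0.maxGenEigenspace μ = ⊤
  L0_bounded : ∃ B : ℝ, ∀ μ : ℂ, μ.re < B → D.L0.maxGenEigenspace μ = ⊥
  Lm1_mem : ∀ n < N, ∀ w ∈ D.gr n, D.Lm1 w ∈ D.gr (n + 1)
  Lm1_top : ∀ w ∈ D.gr N, D.Lm1 w = 0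
  L0_Lm1 : D.L0 * D.Lm1 - D.Lm1 * D.L0 = D.Lm1
  L0_elem : ∀ (k l : ℕ) (hk : k ≤ N) (hl : l ≤ N) (v : V),
    D.L0 * D.theta (elemN hk hl v) - D.theta (elemN hk hl v) * D.L0 =
      ((k : ℂ) - l) • D.theta (elemN hk hl v)
  Lm1_elem : ∀ (k l : ℕ) (hk : k < N) (hl : l < N) (v : V), ∀ w ∈ D.gr l,
    D.Lm1 (D.theta (elemN hk.le hl.le v) w) -
        D.theta (elemN (Nat.succ_le_of_lt hk) (Nat.succ_le_of_lt hl) v) (D.Lm1 w) =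
      D.theta (elemN (Nat.succ_le_of_lt hk) hl.le (LNegOne V v)) w

/-- Graded `A^N(V)`-submodules: graded subspaces invariant under `A^N(V)`, `L(0)` and `L(-1)`.
(The remaining conditions on a graded module are inherited by such subspaces.) -/
structure IsGradedSubmodule (P : Submodule ℂ M) : Prop where
  theta_mem : ∀ (a : UN V N), ∀ w ∈ P, D.theta a w ∈ P
  graded : P = ⨆ n, P ⊓ D.gr n
  L0_mem : ∀ w ∈ P, D.L0 w ∈ P
  Lm1_mem : ∀ w ∈ P, D.Lm1 w ∈ P

/-- The graded submodule `P` is an irreducible graded module. -/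
def IsIrreducibleSub (P : Submodule ℂ M) : Prop :=
  D.IsGradedSubmodule P ∧ P ≠ ⊥ ∧ ∀ P' ≤ P, D.IsGradedSubmodule P' → P' = ⊥ ∨ P' = P

/-- `M` is an irreducible graded module. -/
def IsIrreducible : Prop := D.IsIrreducibleSub ⊤

/-- `M` is a direct sum of irreducible graded submodules. -/
def IsCompletelyReducible : Prop :=
  ∃ 𝔇 : Set (Submodule ℂ M), (∀ P ∈ 𝔇, D.IsIrreducibleSub P) ∧ sSupIndep 𝔇 ∧ sSup 𝔇 = ⊤

/-- Equivalence of graded `A^N(V)`-modules: an `A^N(V)`-linear isomorphism respecting the gradings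
and commuting with `L(0)` and `L(-1)`. -/
def Equivalent {M' : Type*} [AddCommGroup M'] [Module ℂ M'] (D' : GradedData V N M') : Prop :=
  ∃ f : M ≃ₗ[ℂ] M',
    (∀ (a : UN V N) (w : M), f (D.theta a w) = D'.theta a (f w)) ∧
    (∀ n, (D.gr n).map f.toLinearMap = D'.gr n) ∧
    (∀ w, f (D.L0 w) = D'.L0 (f w)) ∧ ∀ w, f (D.Lm1 w) = D'.Lm1 (f w)

end GradedData

end GradedModules

end

/-!
The canonical maps `G_n(W) → Gr_n(W)` are isomorphisms. Let `P` be an irreducible summand with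
lowest weight `h`. A vector in `Ω_n(W) ∩ P_[h+m]` with `n < m` generates a submodule of `P` all of
whose weights exceed `h`, hence vanishes; so `Ω_n(W) ∩ P` is the sum of the spaces `P_[h+m]` with
`m ≤ n`. This transports the structure of graded `A^N(V)`-module from `Gr^N(W)` to `T_N(W)`.

Let `X` be a nonzero graded submodule of `T_N(P)`. Its degree zero part is nonzero because `T_N(P)`
is nondegenerate, and by irreducibility it generates `P`, which is spanned by the vectors
`L(-1)^j v_k a` with `a` in that part. Those of degree at most `N` lie in `X`, so `X = T_N(P)`.
Hence `T_N(W)` is the direct sum of the irreducible modules `T_N(P)`.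
-/

noncomputable section

open GradingRestrictedVertexAlgebra

/-! ### Modes of vertex operators and the product `⋄` -/

section Modes

variable {V W : Type*} [AddCommGroup V] [Module ℂ V] [AddCommGroup W] [Module ℂ W]
  (Y : V →ₗ[ℂ] VertexOperator ℂ W)

theorem vmode_zero (n : ℤ) : vmode Y 0 n = 0 := by
  simp only [vmode, map_zero, Pi.zero_apply]

theorem vmode_add (u v : V) (n : ℤ) : vmode Y (u + v) n = vmode Y u n + vmode Y v n := by
  simp only [vmode, map_add, Pi.add_apply]

theorem exists_vmode_eq_zero (v : V) (w : W) : ∃ K : ℤ, ∀ n, K ≤ n → vmode Y v n w = 0 :=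
  ⟨-(HahnSeries.order ((HahnModule.of ℂ).symm (Y v w))), fun _ hn =>
    VertexOperator.ncoeff_eq_zero_of_lt_order _ _ _ (by omega)⟩

theorem finite_support_vmode (v : V) (w : W) (e : ℤ) (c : ℕ → ℤ) :
    (Function.support fun j : ℕ => c j • vmode Y v (e + j) w).Finite := by
  obtain ⟨K, hK⟩ := exists_vmode_eq_zero Y v w
  refine (Set.finite_Iio (K - e).toNat).subset fun j hj => Set.mem_Iio.2 (not_le.1 fun hKj => hj ?_)
  change c j • vmode Y v (e + j) w = 0
  rw [hK _ (by omega), smul_zero]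

end Modes

section Binomial

variable {R : Type*} [CommRing R] [BinomialRing R]

theorem sum_choose_mul_choose_sub (a : R) (t : ℕ) :
    ∑ m ∈ Finset.range (t + 1), Ring.choose a m * ((-1) ^ (t - m) * Ring.choose (a - m) (t - m)) =
      if t = 0 then 1 else 0 := by
  have term_eq : ∀ m ∈ Finset.range (t + 1),
      Ring.choose a m * ((-1) ^ (t - m) * Ring.choose (a - m) (t - m)) =
        (-1) ^ t * Ring.choose a t * (((-1) ^ m * (t.choose m : ℤ) : ℤ) : R) := by
    intro m hm
    obtain ⟨r, rfl⟩ := Nat.exists_eq_add_of_le (Finset.mem_range_succ_iff.1 hm)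
    have choose_mul := Ring.choose_smul_choose a (Nat.le_add_right m r)
    rw [nsmul_eq_mul] at choose_mul
    have sign_sq : (-1 : R) ^ m * (-1) ^ m = 1 := by rw [← mul_pow]; simp
    rw [Nat.add_sub_cancel_left] at choose_mul ⊢
    push_cast
    linear_combination -(-1) ^ r * choose_mul -
      (-1) ^ r * Ring.choose a (m + r) * ((m + r).choose m : R) * sign_sq
  rw [Finset.sum_congr rfl term_eq, ← Finset.mul_sum, ← Int.cast_sum,
    Int.alternating_sum_range_choose]
  split_ifs with ht
  · simp [ht]
  · simp

theorem sum_choose_smul_sum_choose_smul {X : Type*} [AddCommGroup X] [Module R X] (a : R) (n : ℕ)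
    (f : ℕ → X) :
    ∑ m ∈ Finset.range (n + 1), Ring.choose a m •
      ∑ i ∈ Finset.range (n + 1 - m), ((-1) ^ i * Ring.choose (a - m) i) • f (m + i) = f 0 := by
  simp_rw [Finset.smul_sum, smul_smul]
  rw [← Finset.sum_range_diag_flip (n + 1)
    (fun m i => (Ring.choose a m * ((-1) ^ i * Ring.choose (a - m) i)) • f (m + i))]
  have diagonal : ∀ t, ∑ m ∈ Finset.range (t + 1),
      (Ring.choose a m * ((-1) ^ (t - m) * Ring.choose (a - m) (t - m))) • f (m + (t - m)) =
        if t = 0 then f 0 else 0 := by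
    intro t
    calc _ = ∑ m ∈ Finset.range (t + 1),
          (Ring.choose a m * ((-1) ^ (t - m) * Ring.choose (a - m) (t - m))) • f t :=
          Finset.sum_congr rfl fun m hm => by
            rw [Nat.add_sub_cancel' (Finset.mem_range_succ_iff.1 hm)]
      _ = (if t = 0 then 1 else 0 : R) • f t := by
          rw [← Finset.sum_smul, sum_choose_mul_choose_sub]
      _ = if t = 0 then f 0 else 0 := by
          split_ifs with ht
          · rw [ht, one_smul]
          · rw [zero_smul]
  simp [diagonal]

end Binomial

namespace GradingRestrictedVertexAlgebra

variable {V : Type u} [AddCommGroup V] [Module ℂ V] [GradingRestrictedVertexAlgebra V]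

theorem wt_induction {p : V → Prop} (add : ∀ x y, p x → p y → p (x + y))
    (mem : ∀ d, ∀ v ∈ wt (V := V) d, p v) (v : V) : p v := by
  have hv : v ∈ ⨆ d, wt (V := V) d := by
    simp only [DirectSum.IsInternal.submodule_iSup_eq_top isInternal, Submodule.mem_top]
  exact Submodule.iSup_induction _ (motive := p) hv mem (mem 0 0 (Submodule.zero_mem _)) add

theorem wtProj_of_mem {d : ℤ} {v : V} (hv : v ∈ wt (V := V) d) (e : ℤ) :
    wtProj V e v = if d = e then v else 0 := by
  rw [wtProj, wtLift_of_mem V _ hv]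
  split_ifs <;> rfl

theorem finite_support_wtProj (v : V) : (Function.support fun d => wtProj V d v).Finite := by
  induction v using wt_induction with
  | add x y hx hy =>
    simp only [map_add]
    exact (hx.union hy).subset (Function.support_add _ _)
  | mem d v hv =>
    refine (Set.finite_singleton d).subset fun e he => ?_
    by_contra hne
    exact he ((wtProj_of_mem hv e).trans (if_neg (Ne.symm hne)))

theorem LNegOne_mem {d : ℤ} {v : V} (hv : v ∈ wt (V := V) d) :
    LNegOne V v ∈ wt (V := V) (d + 1) := by
  have h := mode_mem d 0 (-2) v vac hv vac_mem
  rwa [show d + 0 - (-2) - 1 = d + 1 by ring] at h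

theorem LNegOne_add (u v : V) : LNegOne V (u + v) = LNegOne V u + LNegOne V v := by
  simp only [LNegOne, vmode_add, LinearMap.add_apply]

theorem resY_of_mem (e l : ℤ) {d : ℤ} {u : V} (hu : u ∈ wt (V := V) d) (v : V) :
    resY e l u v = ∑ᶠ j : ℕ, Ring.choose (l + d) j • vmode (Y (V := V)) u (e + j) v := by
  rw [resY, finsum_eq_single _ d]
  · simp only [wtProj_of_mem hu, if_true]
  · intro d' hd'
    simp only [wtProj_of_mem hu, if_neg hd'.symm, vmode_zero, LinearMap.zero_apply, smul_zero,
      finsum_zero]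

theorem finite_support_resY (e l : ℤ) (u v : V) : (Function.support fun d : ℤ =>
    ∑ᶠ j : ℕ, Ring.choose (l + d) j • vmode (Y (V := V)) (wtProj V d u) (e + j) v).Finite := by
  refine (finite_support_wtProj u).subset fun d hd => ?_
  contrapose! hd
  have hd' : wtProj V d u = 0 := by simpa using hd
  simp [hd', vmode_zero]

theorem resY_add_left (e l : ℤ) (u u' v : V) :
    resY e l (u + u') v = resY e l u v + resY e l u' v := by
  simp only [resY, map_add, vmode_add, LinearMap.add_apply, smul_add]
  rw [← finsum_add_distrib (finite_support_resY e l u v) (finite_support_resY e l u' v)]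
  exact finsum_congr fun d => finsum_add_distrib (finite_support_vmode Y _ v e _)
    (finite_support_vmode Y _ v e _)

theorem resY_add_right (e l : ℤ) (u v v' : V) :
    resY e l u (v + v') = resY e l u v + resY e l u v' := by
  simp only [resY, map_add, smul_add]
  rw [← finsum_add_distrib (finite_support_resY e l u v) (finite_support_resY e l u v')]
  exact finsum_congr fun d => finsum_add_distrib (finite_support_vmode Y _ v e _)
    (finite_support_vmode Y _ v' e _)

theorem diamondEntry_add_left (k n l : ℕ) (u u' v : V) :
    diamondEntry k n l (u + u') v = diamondEntry k n l u v + diamondEntry k n l u' v := by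
  simp only [diamondEntry, resY_add_left, smul_add, Finset.sum_add_distrib]

theorem diamondEntry_add_right (k n l : ℕ) (u v v' : V) :
    diamondEntry k n l u (v + v') = diamondEntry k n l u v + diamondEntry k n l u v' := by
  simp only [diamondEntry, resY_add_right, smul_add, Finset.sum_add_distrib]

end GradingRestrictedVertexAlgebra

namespace LBGModule

variable {V : Type u} [AddCommGroup V] [Module ℂ V] [GradingRestrictedVertexAlgebra V]
variable {W : Type u} [AddCommGroup W] [Module ℂ W] (S : LBGModule V W)

theorem opShift_eq_zero_of_mem_Omega {n s : ℤ} (h : s < -n) {w : W} (hw : w ∈ S.Omega n) (v : V) :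
    S.opShift s v w = 0 :=
  S.opShift_induction (fun f => f w = 0) rfl
    (fun f g hf hg => by rw [LinearMap.add_apply, hf, hg, add_zero])
    (fun d v hv => hw d _ v hv (by omega)) v

theorem opShift_zero_vac : S.opShift 0 (vac (V := V)) = 1 := by
  rw [S.opShift_of_mem _ vac_mem, S.identity]
  simp

theorem opShift_LNegOne (s : ℤ) (v : V) :
    S.Lm1 * S.opShift s v - S.opShift s v * S.Lm1 = S.opShift (s + 1) (LNegOne V v) := by
  induction v using wt_induction with
  | add x y hx hy =>
    rw [LNegOne_add, map_add, map_add, ← hx, ← hy, mul_add, add_mul]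
    abel
  | mem d v hv =>
    rw [S.opShift_of_mem _ hv, S.opShift_of_mem _ (LNegOne_mem hv), S.Lm1_bracket]
    congr 1
    ring

theorem opShift_resY_eq_finsum {d e : ℤ} {u v : V} (hu : u ∈ wt (V := V) d)
    (hv : v ∈ wt (V := V) e) (s l p : ℤ) (w : W) :
    S.opShift s (resY p l u v) w = ∑ᶠ i : ℕ, Ring.choose (l + d) i •
      vmode S.Y (vmode (GradingRestrictedVertexAlgebra.Y (V := V)) u (p + i) v)
        (l + d + (e - 2 - s - p - l) - i) w := by
  rw [resY_of_mem _ _ hu]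
  refine (AddMonoidHom.map_finsum ((S.opShift s).flip w).toAddMonoidHom
    (finite_support_vmode (GradingRestrictedVertexAlgebra.Y (V := V)) u v p _)).trans
    (finsum_congr fun i => ?_)
  simp only [LinearMap.toAddMonoidHom_coe, LinearMap.flip_apply, map_zsmul]
  rw [S.opShift_of_mem _ (mode_mem d e (p + i) u v hu hv)]
  congr 3
  ring

/-- On `Ω_l(W)` the modes `u_{l + d + i}` vanish, so the Jacobi identity loses its second sum. -/
theorem opShift_resY_of_mem_Omega {d e : ℤ} {u v : V} (hu : u ∈ wt (V := V) d)
    (hv : v ∈ wt (V := V) e) {l : ℤ} {w : W} (hw : w ∈ S.Omega l) (s p : ℤ) (r : ℕ)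
    (hr : s + p + 2 * l + 1 ≤ r) :
    S.opShift s (resY p l u v) w =
      ∑ i ∈ Finset.range (r + 1), ((-1 : ℤ) ^ i * Ring.choose p i) •
        vmode S.Y u (l + d + p - i) (vmode S.Y v (e - 2 - s - p - l + i) w) := by
  rw [S.opShift_resY_eq_finsum hu hv, S.jacobi]
  have hu_zero : ∀ i : ℕ, vmode S.Y u (l + d + i) w = 0 := fun i => hw d _ u hu (by omega)
  simp only [hu_zero, map_zero, smul_zero, sub_zero]
  refine finsum_eq_sum_of_support_subset _ fun i hi => ?_
  by_contra hir
  simp only [Finset.coe_range, Set.mem_Iio, not_lt] at hir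
  refine hi ?_
  change _ • _ = _
  rw [hw e _ v hv (by omega), map_zero, smul_zero]

theorem opShift_diamondEntry (k n l : ℕ) (u v : V) {w : W} (hw : w ∈ S.Omega l) :
    S.opShift ((k : ℤ) - l) (diamondEntry k n l u v) w =
      S.opShift ((k : ℤ) - n) u (S.opShift ((n : ℤ) - l) v w) := by
  induction u using wt_induction with
  | add x y hx hy => simp only [diamondEntry_add_left, map_add, LinearMap.add_apply, hx, hy]
  | mem d u hu =>
  induction v using wt_induction with
  | add x y hx hy => simp only [diamondEntry_add_right, map_add, LinearMap.add_apply, hx, hy]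
  | mem e v hv =>
  have collapse := sum_choose_smul_sum_choose_smul (-(k : ℤ) + n - l - 1) n (fun t =>
    vmode S.Y u (d - 1 - (k - n + t)) (vmode S.Y v (e - 1 - (n - l - t)) w))
  simp only [Nat.cast_zero, add_zero, sub_zero] at collapse
  rw [diamondEntry, map_sum, LinearMap.sum_apply, S.opShift_of_mem _ hu, S.opShift_of_mem _ hv,
    ← collapse]
  refine Finset.sum_congr rfl fun m hm => ?_
  have hmn : m ≤ n := Finset.mem_range_succ_iff.1 hm
  rw [map_zsmul, LinearMap.smul_apply,
    S.opShift_resY_of_mem_Omega hu hv hw _ _ (n - m) (by push_cast [hmn]; linarith),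
    show n - m + 1 = n + 1 - m by omega]
  congr 1
  refine Finset.sum_congr rfl fun i _ => ?_
  congr 3 <;> push_cast <;> ring_nf

end LBGModule

/-! ### Generalized eigenspaces of operators on spaces of arbitrary dimension -/

section Eigenspaces

open Polynomial in
theorem mem_of_sum_mem_of_mem_maxGenEigenspace {K M ι : Type*} [Field K] [AddCommGroup M]
    [Module K M] {f : Module.End K M} {p : Submodule K M} (hp : ∀ x ∈ p, f x ∈ p) {s : Finset ι}
    {μ : ι → K} (hμ : Set.InjOn μ s) {x : ι → M}
    (hx : ∀ i ∈ s, x i ∈ f.maxGenEigenspace (μ i)) (hsum : ∑ i ∈ s, x i ∈ p) {i : ι} (hi : i ∈ s) :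
    x i ∈ p := by
  classical
  simp only [Module.End.mem_maxGenEigenspace] at hx
  choose! k hk using hx
  have annihilates : ∀ j ∈ s, aeval f ((X - C (μ j)) ^ k j) (x j) = 0 := fun j hj => by
    simpa [Algebra.algebraMap_eq_smul_one] using hk j hj
  set q : K[X] := ∏ j ∈ s.erase i, (X - C (μ j)) ^ k j
  have q_annihilates : ∀ j ∈ s, j ≠ i → aeval f q (x j) = 0 := fun j hj hji => by
    obtain ⟨r, hr⟩ := Finset.dvd_prod_of_mem (fun j => (X - C (μ j)) ^ k j)
      (Finset.mem_erase.2 ⟨hji, hj⟩)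
    rw [show q = r * (X - C (μ j)) ^ k j from hr.trans (mul_comm _ _), map_mul,
      Module.End.mul_apply, annihilates j hj, map_zero]
  have q_mem : aeval f q (x i) ∈ p := by
    have h := aeval_apply_smul_mem_of_le_comap hsum q f hp
    rwa [map_sum, Finset.sum_eq_single_of_mem i hi q_annihilates] at h
  have coprime : IsCoprime ((X - C (μ i)) ^ k i) q := IsCoprime.prod_right fun j hj =>
    have hji := Finset.mem_erase.1 hj
    (isCoprime_X_sub_C_of_isUnit_sub
      (sub_ne_zero.2 fun h => hji.1 (hμ hi hji.2 h).symm).isUnit).pow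
  obtain ⟨a, b, hab⟩ := coprime
  have hxi := congrArg (fun r => aeval f r (x i)) hab
  simp only [map_add, map_mul, LinearMap.add_apply, Module.End.mul_apply, annihilates i hi,
    map_zero, zero_add, map_one, Module.End.one_apply] at hxi
  exact hxi ▸ aeval_apply_smul_mem_of_le_comap q_mem b f hp

variable {K M : Type*} [Field K] [AddCommGroup M] [Module K M] {f : Module.End K M}

theorem le_iSup_inf_maxGenEigenspace {p : Submodule K M} (hp : ∀ x ∈ p, f x ∈ p) (s : Set K)
    (h : p ≤ ⨆ μ ∈ s, f.maxGenEigenspace μ) : p ≤ ⨆ μ ∈ s, p ⊓ f.maxGenEigenspace μ := by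
  intro w hw
  have hw' := h hw
  rw [iSup_subtype', Submodule.mem_iSup_iff_exists_finsupp] at hw'
  obtain ⟨y, hy, rfl⟩ := hw'
  refine Submodule.sum_mem _ fun i hi => Submodule.mem_iSup_of_mem i.1
    (Submodule.mem_iSup_of_mem i.2 ⟨?_, hy i⟩)
  exact mem_of_sum_mem_of_mem_maxGenEigenspace hp (Subtype.val_injective.injOn)
    (fun i _ => hy i) hw hi

theorem maxGenEigenspace_eq_bot_of_notMem {s : Set K}
    (h : ⨆ μ ∈ s, f.maxGenEigenspace μ = ⊤) {μ : K} (hμ : μ ∉ s) : f.maxGenEigenspace μ = ⊥ := by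
  have hdisj := f.independent_maxGenEigenspace.disjoint_biSup hμ
  rwa [h, disjoint_top] at hdisj

theorem biSup_maxGenEigenspace_eq_top {s : Set K} (h : ⨆ μ, f.maxGenEigenspace μ = ⊤)
    (hs : ∀ μ, μ ∉ s → f.maxGenEigenspace μ = ⊥) : ⨆ μ ∈ s, f.maxGenEigenspace μ = ⊤ := by
  refine top_le_iff.1 (h ▸ iSup_le fun μ => ?_)
  by_cases hμ : μ ∈ s
  · exact le_iSup₂_of_le μ hμ le_rfl
  · simp only [hs μ hμ, bot_le]

theorem biSup_maxGenEigenspace_restrict {p : Submodule K M} (hp : ∀ x ∈ p, f x ∈ p) {s : Set K}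
    (h : ⨆ μ ∈ s, f.maxGenEigenspace μ = ⊤) :
    ⨆ μ ∈ s, Module.End.maxGenEigenspace (f.restrict hp) μ = ⊤ := by
  have hle := le_iSup_inf_maxGenEigenspace hp s (h ▸ le_top)
  have hinf : ∀ μ, p ⊓ f.maxGenEigenspace μ =
      (Module.End.maxGenEigenspace (f.restrict hp) μ).map p.subtype :=
    fun μ => Submodule.inf_genEigenspace f p hp
  simp_rw [hinf, ← Submodule.map_iSup] at hle
  refine top_le_iff.1 fun x _ => ?_
  obtain ⟨y, hy, hyx⟩ := hle x.2
  rwa [← Subtype.ext hyx]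

theorem map_mem_maxGenEigenspace {Z : Type*} [AddCommGroup Z] [Module K Z] {g : Module.End K Z}
    (φ : M →ₗ[K] Z) (h : ∀ x, φ (f x) = g (φ x)) {μ : K} {x : M}
    (hx : x ∈ f.maxGenEigenspace μ) : φ x ∈ g.maxGenEigenspace μ := by
  rw [Module.End.mem_maxGenEigenspace] at hx ⊢
  obtain ⟨k, hk⟩ := hx
  have semiconj : Function.Semiconj φ (f - μ • 1 : Module.End K M) (g - μ • 1 : Module.End K Z) :=
    fun x => by simp [h]
  refine ⟨k, ?_⟩
  rw [Module.End.pow_apply] at hk ⊢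
  rw [← semiconj.iterate_right k x, hk, map_zero]

theorem biSup_maxGenEigenspace_of_iSup_range {ι : Type*} {A : ι → Type*}
    [∀ i, AddCommGroup (A i)] [∀ i, Module K (A i)] {g : ∀ i, Module.End K (A i)}
    (φ : ∀ i, A i →ₗ[K] M) (h : ∀ i x, φ i (g i x) = f (φ i x))
    (hφ : ⨆ i, LinearMap.range (φ i) = ⊤) {s : Set K}
    (hg : ∀ i, ⨆ μ ∈ s, (g i).maxGenEigenspace μ = ⊤) : ⨆ μ ∈ s, f.maxGenEigenspace μ = ⊤ := by
  refine top_le_iff.1 (hφ ▸ iSup_le fun i => ?_)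
  rw [← Submodule.map_top, ← hg i, Submodule.map_iSup]
  refine iSup_mono fun μ => ?_
  rw [Submodule.map_iSup]
  refine iSup_mono fun _ => ?_
  rintro _ ⟨x, hx, rfl⟩
  exact map_mem_maxGenEigenspace (φ i) (h i) hx

theorem biSup_maxGenEigenspace_of_surjective {Z : Type*} [AddCommGroup Z] [Module K Z]
    {g : Module.End K Z} (φ : M →ₗ[K] Z) (h : ∀ x, φ (f x) = g (φ x)) (hφ : Function.Surjective φ)
    {s : Set K} (hf : ⨆ μ ∈ s, f.maxGenEigenspace μ = ⊤) : ⨆ μ ∈ s, g.maxGenEigenspace μ = ⊤ :=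
  biSup_maxGenEigenspace_of_iSup_range (ι := Unit) (fun _ => φ) (fun _ => h)
    (by rw [iSup_const, LinearMap.range_eq_top.2 hφ]) fun _ => hf

end Eigenspaces

/-! ### Truncations of graded systems -/

section System

variable {V : Type u} [AddCommGroup V] [Module ℂ V]
variable {G : ℕ → Type u} [∀ n, AddCommGroup (G n)] [∀ n, Module ℂ (G n)]

theorem matAct_lof (act : ∀ k l : ℕ, V →ₗ[ℂ] G l →ₗ[ℂ] G k) (a : UInf V) (l : ℕ) (x : G l) :
    matAct act a (DirectSum.lof ℂ ℕ G l x) =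
      (a l).sum fun k v => DirectSum.lof ℂ ℕ G k (act k l v x) := by
  simp only [matAct, LinearMap.coe_mk, AddHom.coe_mk, DirectSum.toModule_lof, Finsupp.sum,
    LinearMap.sum_apply, LinearMap.comp_apply]

theorem matAct_elem_lof (act : ∀ k l : ℕ, V →ₗ[ℂ] G l →ₗ[ℂ] G k) (k l : ℕ) (v : V) (x : G l) :
    matAct act (elem k l v) (DirectSum.lof ℂ ℕ G l x) = DirectSum.lof ℂ ℕ G k (act k l v x) := by
  rw [matAct_lof, elem, Pi.single_eq_same, Finsupp.sum_single_index (by simp)]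

theorem matAct_elem_lof_of_ne (act : ∀ k l : ℕ, V →ₗ[ℂ] G l →ₗ[ℂ] G k) (k : ℕ) {l n : ℕ}
    (h : n ≠ l) (v : V) (x : G n) : matAct act (elem k l v) (DirectSum.lof ℂ ℕ G n x) = 0 := by
  rw [matAct_lof, elem, Pi.single_eq_of_ne h, Finsupp.sum_zero_index]

theorem degZero_lof (f : ∀ n, Module.End ℂ (G n)) (n : ℕ) (x : G n) :
    degZero f (DirectSum.lof ℂ ℕ G n x) = DirectSum.lof ℂ ℕ G n (f n x) := by
  simp [degZero]

theorem degOne_lof_of_lt {N n : ℕ} (h : n < N) (f : ∀ n, G n →ₗ[ℂ] G (n + 1)) (x : G n) :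
    degOne N f (DirectSum.lof ℂ ℕ G n x) = DirectSum.lof ℂ ℕ G (n + 1) (f n x) := by
  simp [degOne, h]

theorem degOne_lof_of_le {N n : ℕ} (h : N ≤ n) (f : ∀ n, G n →ₗ[ℂ] G (n + 1)) (x : G n) :
    degOne N f (DirectSum.lof ℂ ℕ G n x) = 0 := by
  simp [degOne, not_lt.2 h]

variable (G) in
/-- The inclusion of `G n` into the truncation `⨁_{m ≤ N} G m`, for `n ≤ N`. -/
def lofUpTo {N n : ℕ} (h : n ≤ N) : G n →ₗ[ℂ] upTo G N :=
  (DirectSum.lof ℂ ℕ G n).codRestrict _ (lof_mem_upTo h)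

theorem lofUpTo_apply_self {N n : ℕ} (h : n ≤ N) (x : G n) : (lofUpTo G h x).1 n = x :=
  DirectSum.component.lof_self ℂ n x

theorem iSup_range_lofUpTo (N : ℕ) :
    ⨆ n : Fin (N + 1), LinearMap.range (lofUpTo G (Nat.lt_succ_iff.1 n.2)) = ⊤ := by
  apply Submodule.map_injective_of_injective (upTo G N).injective_subtype
  rw [Submodule.map_iSup, Submodule.map_top, Submodule.range_subtype]
  refine iSup_congr fun n => ?_
  rw [← LinearMap.range_comp]
  rfl

theorem upTo_hom_ext {N : ℕ} {Z : Type*} [AddCommGroup Z] [Module ℂ Z]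
    {f g : upTo G N →ₗ[ℂ] Z} (h : ∀ (n : ℕ) (hn : n ≤ N) (x : G n),
      f (lofUpTo G hn x) = g (lofUpTo G hn x)) : f = g := by
  rw [← LinearMap.eqLocus_eq_top, ← top_le_iff, ← iSup_range_lofUpTo]
  refine iSup_le fun n => ?_
  rintro _ ⟨x, rfl⟩
  exact h n (Nat.lt_succ_iff.1 n.2) x

theorem component_eq_zero_of_mem_upTo {N n : ℕ} (h : N < n) {x : ⨁ n, G n} (hx : x ∈ upTo G N) :
    x n = 0 := by
  suffices upTo G N ≤ LinearMap.ker (DirectSum.component ℂ ℕ G n) from this hx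
  refine iSup_le fun m => ?_
  rintro _ ⟨y, rfl⟩
  rw [LinearMap.mem_ker, DirectSum.component.of, dif_neg (by omega)]

variable {act : ∀ k l : ℕ, V →ₗ[ℂ] G l →ₗ[ℂ] G k} {L0 : ∀ n, Module.End ℂ (G n)}
  {Lm1 : ∀ n, G n →ₗ[ℂ] G (n + 1)} {N : ℕ}

theorem lofUpTo_mem_gr {n : ℕ} (hn : n ≤ N) (x : G n) :
    lofUpTo G hn x ∈ (truncData N act L0 Lm1).gr n := ⟨x, rfl⟩

theorem exists_lofUpTo_of_mem_gr {n : ℕ} (hn : n ≤ N) {x : upTo G N}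
    (hx : x ∈ (truncData N act L0 Lm1).gr n) : ∃ y, lofUpTo G hn y = x :=
  hx.imp fun _ hy => Subtype.ext hy

theorem truncData_elem_lofUpTo {k l : ℕ} (hk : k ≤ N) (hl : l ≤ N) (v : V) (x : G l) :
    (truncData N act L0 Lm1).theta (elemN hk hl v) (lofUpTo G hl x) =
      lofUpTo G hk (act k l v x) :=
  Subtype.ext (matAct_elem_lof act k l v x)

theorem truncData_L0_lofUpTo {n : ℕ} (hn : n ≤ N) (x : G n) :
    (truncData N act L0 Lm1).L0 (lofUpTo G hn x) = lofUpTo G hn (L0 n x) :=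
  Subtype.ext (degZero_lof L0 n x)

theorem truncData_Lm1_lofUpTo {n : ℕ} (hn : n < N) (x : G n) :
    (truncData N act L0 Lm1).Lm1 (lofUpTo G hn.le x) =
      lofUpTo G (Nat.succ_le_of_lt hn) (Lm1 n x) :=
  Subtype.ext (degOne_lof_of_lt hn Lm1 x)

theorem truncData_Lm1_lofUpTo_top (x : G N) :
    (truncData N act L0 Lm1).Lm1 (lofUpTo G le_rfl x) = 0 :=
  Subtype.ext (degOne_lof_of_le le_rfl Lm1 x)

theorem truncData_elem_of_ne {k l n : ℕ} (hk : k ≤ N) (hl : l ≤ N) (v : V) (h : n ≠ l)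
    {w : upTo G N} (hw : w ∈ (truncData N act L0 Lm1).gr n) :
    (truncData N act L0 Lm1).theta (elemN hk hl v) w = 0 := by
  obtain ⟨y, hy⟩ := hw
  refine Subtype.ext ?_
  change matAct act (elem k l v) ((upTo G N).subtype w) = 0
  rw [← hy, matAct_elem_lof_of_ne act k h]

theorem truncData_gr_isInternal : DirectSum.IsInternal (truncData N act L0 Lm1).gr := by
  refine DirectSum.isInternal_submodule_of_iSupIndep_of_iSup_eq_top (fun n => ?_) ?_
  · rw [Submodule.disjoint_def]
    rintro x ⟨y, hy⟩ hx
    have others_le : (⨆ (m : ℕ) (_ : m ≠ n), (truncData N act L0 Lm1).gr m) ≤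
        LinearMap.ker (DirectSum.component ℂ ℕ G n ∘ₗ (upTo G N).subtype) := by
      refine iSup₂_le fun m hm => ?_
      rintro z ⟨t, ht⟩
      rw [LinearMap.mem_ker, LinearMap.comp_apply, ← ht, DirectSum.component.of, dif_neg hm]
    have hxn := others_le hx
    rw [LinearMap.mem_ker, LinearMap.comp_apply, ← hy, DirectSum.component.lof_self] at hxn
    rw [hxn, map_zero] at hy
    exact Subtype.ext hy.symm
  · refine top_le_iff.1 (iSup_range_lofUpTo (G := G) N ▸ iSup_le fun n => ?_)
    refine le_trans ?_ (le_iSup _ (n : ℕ))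
    rintro _ ⟨x, rfl⟩
    exact lofUpTo_mem_gr _ x

theorem truncData_gr_eq_bot {n : ℕ} (hn : N < n) : (truncData N act L0 Lm1).gr n = ⊥ := by
  rw [Submodule.eq_bot_iff]
  rintro x ⟨y, hy⟩
  have hxn := component_eq_zero_of_mem_upTo hn x.2
  rw [← Submodule.subtype_apply, ← hy] at hxn
  have hy_zero : y = 0 := (DirectSum.component.lof_self ℂ n y).symm.trans hxn
  rw [hy_zero, map_zero] at hy
  exact Subtype.ext hy.symm

end System

section GradedSystem

variable {V : Type u} [AddCommGroup V] [Module ℂ V] [GradingRestrictedVertexAlgebra V]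
variable {G : ℕ → Type u} [∀ n, AddCommGroup (G n)] [∀ n, Module ℂ (G n)]

/-- A graded `A^∞(V)`-module `⨁ n, G n` without an upper bound on the degrees, presented by the
components `act k l v : G l → G k` of the action and the components of `L(0)` and `L(-1)`. The
`N`-truncation of such a system is a graded `A^N(V)`-module. -/
structure IsGradedSystem (act : ∀ k l : ℕ, V →ₗ[ℂ] G l →ₗ[ℂ] G k) (L0 : ∀ n, Module.End ℂ (G n))
    (Lm1 : ∀ n, G n →ₗ[ℂ] G (n + 1)) : Prop where
  matAct_eq_zero : ∀ a ∈ QInf V, matAct act a = 0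
  act_diamondEntry : ∀ k n l u v (x : G l),
    act k l (diamondEntry k n l u v) x = act k n u (act n l v x)
  act_vac : ∀ k (x : G k), act k k vac x = x
  eq_zero_of_act_zero : ∀ l (x : G l), (∀ v, act 0 l v x = 0) → x = 0
  exists_spectral_bound : ∃ B : ℝ, ∀ n, ⨆ μ ∈ {μ : ℂ | B ≤ μ.re}, (L0 n).maxGenEigenspace μ = ⊤
  L0_Lm1 : ∀ n x, L0 (n + 1) (Lm1 n x) - Lm1 n (L0 n x) = Lm1 n x
  L0_act : ∀ k l v x, L0 k (act k l v x) - act k l v (L0 l x) = ((k : ℂ) - l) • act k l v x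
  Lm1_act : ∀ k l v x, Lm1 k (act k l v x) - act (k + 1) (l + 1) v (Lm1 l x) =
    act (k + 1) l (LNegOne V v) x

theorem exists_eq_comp_of_ker_le {K A B C : Type*} [Field K] [AddCommGroup A] [Module K A]
    [AddCommGroup B] [Module K B] [AddCommGroup C] [Module K C] {f : A →ₗ[K] B}
    (hf : Function.Surjective f) {g : A →ₗ[K] C} (h : LinearMap.ker f ≤ LinearMap.ker g) :
    ∃ θ : B →ₗ[K] C, ∀ a, g a = θ (f a) := by
  obtain ⟨r, hr⟩ := f.exists_rightInverse_of_surjective (LinearMap.range_eq_top.2 hf)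
  refine ⟨g ∘ₗ r, fun a => ?_⟩
  have sub_mem_ker : a - r (f a) ∈ LinearMap.ker f := by
    rw [LinearMap.mem_ker, map_sub, ← LinearMap.comp_apply f r, hr, LinearMap.id_apply, sub_self]
  exact sub_eq_zero.1 ((map_sub g _ _).symm.trans (h sub_mem_ker))

theorem toAN_surjective (N : ℕ) : Function.Surjective (toAN V N) := by
  rintro ⟨_, a, ha, rfl⟩
  exact ⟨⟨a, ha⟩, rfl⟩

namespace IsGradedSystem

variable {act : ∀ k l : ℕ, V →ₗ[ℂ] G l →ₗ[ℂ] G k} {L0 : ∀ n, Module.End ℂ (G n)}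
  {Lm1 : ∀ n, G n →ₗ[ℂ] G (n + 1)} (h : IsGradedSystem act L0 Lm1) (N : ℕ)

include h

theorem matAct_diamond (a b : UInf V) :
    matAct act (diamond a b) = matAct act a * matAct act b := by
  refine DirectSum.linearMap_ext _ fun l => LinearMap.ext fun x => ?_
  rw [LinearMap.comp_apply, LinearMap.comp_apply, Module.End.mul_apply, matAct_lof, matAct_lof,
    map_finsuppSum]
  let column : (ℕ →₀ V) →+ ⨁ n, G n := Finsupp.liftAddHom fun k =>
    (DirectSum.lof ℂ ℕ G k ∘ₗ (act k l).flip x).toAddMonoidHom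
  have column_apply : ∀ c : ℕ →₀ V,
      (c.sum fun k v => DirectSum.lof ℂ ℕ G k (act k l v x)) = column c := fun _ => rfl
  rw [column_apply, diamond, map_finsuppSum]
  refine Finsupp.sum_congr fun n _ => ?_
  rw [map_finsuppSum, matAct_lof]
  refine Finsupp.sum_congr fun k _ => ?_
  rw [← column_apply, Finsupp.sum_single_index (by simp), h.act_diamondEntry]

theorem truncData_factors : ∃ θ : AN V N →ₗ[ℂ] Module.End ℂ (upTo G N),
    ∀ a, (truncData N act L0 Lm1).theta a = θ (toAN V N a) := by
  refine exists_eq_comp_of_ker_le (C := Module.End ℂ (upTo G N)) (toAN_surjective N)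
    fun a ha => ?_
  have ha_mem : a.1 ∈ QInf V :=
    (Submodule.Quotient.mk_eq_zero (QInf V)).1 (congrArg Subtype.val (LinearMap.mem_ker.1 ha))
  refine LinearMap.mem_ker.2 (LinearMap.ext fun x => Subtype.ext ?_)
  exact congrArg (fun f : Module.End ℂ (⨁ n, G n) => f x) (h.matAct_eq_zero _ ha_mem)

theorem truncData_theta_oneN : (truncData N act L0 Lm1).theta (oneN V N) = 1 := by
  refine upTo_hom_ext fun n hn x => ?_
  rw [oneN, map_sum, LinearMap.sum_apply, Finset.sum_eq_single ⟨n, Nat.lt_succ_of_le hn⟩]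
  · rw [truncData_elem_lofUpTo, h.act_vac, Module.End.one_apply]
  · intro k _ hk
    exact truncData_elem_of_ne _ _ _ (fun hnk => hk (Fin.ext hnk.symm)) (lofUpTo_mem_gr hn x)
  · simp

theorem truncData_eq_zero {l : ℕ} (hl : l ≤ N) {w : upTo G N}
    (hw : w ∈ (truncData N act L0 Lm1).gr l)
    (hzero : ∀ v, (truncData N act L0 Lm1).theta (elemN (Nat.zero_le N) hl v) w = 0) : w = 0 := by
  obtain ⟨y, rfl⟩ := exists_lofUpTo_of_mem_gr hl hw
  rw [h.eq_zero_of_act_zero l y fun v => ?_, map_zero]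
  rw [← lofUpTo_apply_self (Nat.zero_le N) (act 0 l v y),
    ← truncData_elem_lofUpTo (L0 := L0) (Lm1 := Lm1) _ hl, hzero]
  rfl

theorem exists_truncData_spectral_bound : ∃ B : ℝ, ⨆ μ ∈ {μ : ℂ | B ≤ μ.re},
    (truncData N act L0 Lm1).L0.maxGenEigenspace μ = ⊤ :=
  h.exists_spectral_bound.imp fun _ hB => biSup_maxGenEigenspace_of_iSup_range
    (fun n : Fin (N + 1) => lofUpTo G (Nat.lt_succ_iff.1 n.2))
    (fun _ x => (truncData_L0_lofUpTo _ x).symm) (iSup_range_lofUpTo N) fun n => hB n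

theorem truncData_L0_Lm1 : (truncData N act L0 Lm1).L0 * (truncData N act L0 Lm1).Lm1 -
    (truncData N act L0 Lm1).Lm1 * (truncData N act L0 Lm1).L0 =
      (truncData N act L0 Lm1).Lm1 := by
  refine upTo_hom_ext fun n hn x => ?_
  rw [LinearMap.sub_apply, Module.End.mul_apply, Module.End.mul_apply, truncData_L0_lofUpTo]
  rcases hn.lt_or_eq with hlt | rfl
  · rw [truncData_Lm1_lofUpTo hlt, truncData_Lm1_lofUpTo hlt, truncData_L0_lofUpTo, ← map_sub,
      h.L0_Lm1]
  · rw [truncData_Lm1_lofUpTo_top, truncData_Lm1_lofUpTo_top, map_zero, sub_zero]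

theorem truncData_L0_elem {k l : ℕ} (hk : k ≤ N) (hl : l ≤ N) (v : V) :
    (truncData N act L0 Lm1).L0 * (truncData N act L0 Lm1).theta (elemN hk hl v) -
      (truncData N act L0 Lm1).theta (elemN hk hl v) * (truncData N act L0 Lm1).L0 =
        ((k : ℂ) - l) • (truncData N act L0 Lm1).theta (elemN hk hl v) := by
  refine upTo_hom_ext fun n hn x => ?_
  rw [LinearMap.sub_apply, Module.End.mul_apply, Module.End.mul_apply, LinearMap.smul_apply,
    truncData_L0_lofUpTo]
  rcases eq_or_ne n l with rfl | hnl
  · rw [truncData_elem_lofUpTo, truncData_elem_lofUpTo, truncData_L0_lofUpTo, ← map_sub,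
      h.L0_act, map_smul]
  · rw [truncData_elem_of_ne _ _ _ hnl (lofUpTo_mem_gr hn x),
      truncData_elem_of_ne _ _ _ hnl (lofUpTo_mem_gr hn _), map_zero, smul_zero, sub_zero]

theorem isGradedModule_truncData : (truncData N act L0 Lm1).IsGradedModule where
  factors := h.truncData_factors N
  map_diamond a b := LinearMap.ext fun x => Subtype.ext
    (congrArg (fun f : Module.End ℂ (⨁ n, G n) => f x) (h.matAct_diamond a.1 b.1))
  map_one := h.truncData_theta_oneN N
  isInternal := truncData_gr_isInternal
  gr_eq_bot _ hn := truncData_gr_eq_bot hn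
  elem_ne _ _ _ hk hl v hnl _ hw := truncData_elem_of_ne hk hl v hnl hw
  elem_mem _ _ hk hl v w hw := by
    obtain ⟨y, rfl⟩ := exists_lofUpTo_of_mem_gr hl hw
    rw [truncData_elem_lofUpTo]
    exact lofUpTo_mem_gr hk _
  nondegenerate _ hl _ hw hzero := h.truncData_eq_zero N hl hw hzero
  L0_graded := by
    obtain ⟨B, hB⟩ := h.exists_truncData_spectral_bound N
    exact top_le_iff.1 (hB ▸ iSup₂_le fun μ _ => le_iSup _ μ)
  L0_bounded := (h.exists_truncData_spectral_bound N).imp fun _ hB _ hμ =>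
    maxGenEigenspace_eq_bot_of_notMem hB (not_le.2 hμ)
  Lm1_mem n hn w hw := by
    obtain ⟨y, rfl⟩ := exists_lofUpTo_of_mem_gr hn.le hw
    rw [truncData_Lm1_lofUpTo hn]
    exact lofUpTo_mem_gr _ _
  Lm1_top w hw := by
    obtain ⟨y, rfl⟩ := exists_lofUpTo_of_mem_gr le_rfl hw
    exact truncData_Lm1_lofUpTo_top y
  L0_Lm1 := h.truncData_L0_Lm1 N
  L0_elem _ _ hk hl v := h.truncData_L0_elem N hk hl v
  Lm1_elem k l hk hl v w hw := by
    obtain ⟨y, rfl⟩ := exists_lofUpTo_of_mem_gr hl.le hw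
    rw [truncData_elem_lofUpTo, truncData_Lm1_lofUpTo hk, truncData_Lm1_lofUpTo hl,
      truncData_elem_lofUpTo, truncData_elem_lofUpTo, ← map_sub, h.Lm1_act]

end IsGradedSystem

end GradedSystem

namespace LBGModule

variable {V : Type u} [AddCommGroup V] [Module ℂ V] [GradingRestrictedVertexAlgebra V]
variable {W : Type u} [AddCommGroup W] [Module ℂ W] (S : LBGModule V W)

theorem Gr_mk_eq_zero {n : ℕ} {x : S.Omega n} :
    (Submodule.Quotient.mk x : S.Gr n) = 0 ↔ (x : W) ∈ S.Omega ((n : ℤ) - 1) :=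
  Submodule.Quotient.mk_eq_zero _

theorem exists_spectral_bound :
    ∃ B : ℝ, ⨆ μ ∈ {μ : ℂ | B ≤ μ.re}, S.L0.maxGenEigenspace μ = ⊤ :=
  S.bounded.imp fun _ hB => biSup_maxGenEigenspace_eq_top S.graded fun μ hμ => hB μ (not_le.1 hμ)

theorem eq_zero_of_grAct_zero {l : ℕ} {x : S.Gr l} (h : ∀ v, S.grAct 0 l v x = 0) : x = 0 := by
  obtain ⟨x, rfl⟩ := Submodule.Quotient.mk_surjective _ x
  rw [Gr_mk_eq_zero]
  intro d k v hv hk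
  rcases lt_or_ge (d - k - 1) (-(l : ℤ)) with hlt | hge
  · exact x.2 d k v hv hlt
  · have opShift_mem : S.opShift ((0 : ℕ) - l) v (x : W) ∈ S.Omega (((0 : ℕ) : ℤ) - 1) :=
      S.Gr_mk_eq_zero.1 (h v)
    rw [Nat.cast_zero, zero_sub, zero_sub, S.Omega_neg_one, Submodule.mem_bot,
      S.opShift_of_mem _ hv] at opShift_mem
    rwa [show k = d - 1 - -(l : ℤ) by omega]

theorem grLm1_grAct (k l : ℕ) (v : V) (x : S.Gr l) :
    S.grLm1 k (S.grAct k l v x) - S.grAct (k + 1) (l + 1) v (S.grLm1 l x) =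
      S.grAct (k + 1) l (LNegOne V v) x := by
  obtain ⟨x, rfl⟩ := Submodule.Quotient.mk_surjective _ x
  have bracket := congrArg (fun f : Module.End ℂ W => f x) (S.opShift_LNegOne ((k : ℤ) - l) v)
  refine congrArg Submodule.Quotient.mk (Subtype.ext ?_)
  change S.Lm1 (S.opShift _ v x) - S.opShift (((k + 1 : ℕ) : ℤ) - ((l + 1 : ℕ) : ℤ)) v (S.Lm1 x) =
    S.opShift (((k + 1 : ℕ) : ℤ) - l) _ x
  rwa [show ((k + 1 : ℕ) : ℤ) - ((l + 1 : ℕ) : ℤ) = k - l by push_cast; ring,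
    show ((k + 1 : ℕ) : ℤ) - l = k - l + 1 by push_cast; ring]

theorem biSup_maxGenEigenspace_grL0 {s : Set ℂ} (hs : ⨆ μ ∈ s, S.L0.maxGenEigenspace μ = ⊤)
    (n : ℕ) : ⨆ μ ∈ s, (S.grL0 n).maxGenEigenspace μ = ⊤ :=
  biSup_maxGenEigenspace_of_surjective
    (f := S.L0.restrict fun x (hx : x ∈ S.Omega n) => by simpa using S.L0_mem_Omega n x hx)
    (Submodule.mkQ _) (fun _ => rfl) (Submodule.mkQ_surjective _)
    (biSup_maxGenEigenspace_restrict _ hs)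

theorem isGradedSystem_Gr : IsGradedSystem S.grAct S.grL0 S.grLm1 where
  matAct_eq_zero a ha := by
    simp only [QInf, Submodule.mem_iInf] at ha
    exact ha W _ _ S
  act_diamondEntry k n l u v x := by
    obtain ⟨x, rfl⟩ := Submodule.Quotient.mk_surjective _ x
    exact congrArg Submodule.Quotient.mk (Subtype.ext (S.opShift_diamondEntry k n l u v x.2))
  act_vac k x := by
    obtain ⟨x, rfl⟩ := Submodule.Quotient.mk_surjective _ x
    refine congrArg Submodule.Quotient.mk (Subtype.ext ?_)
    change S.opShift ((k : ℤ) - k) vac (x : W) = x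
    rw [sub_self, S.opShift_zero_vac, Module.End.one_apply]
  eq_zero_of_act_zero _ _ := S.eq_zero_of_grAct_zero
  exists_spectral_bound := S.exists_spectral_bound.imp fun _ => S.biSup_maxGenEigenspace_grL0
  L0_Lm1 n x := by
    obtain ⟨x, rfl⟩ := Submodule.Quotient.mk_surjective _ x
    exact congrArg Submodule.Quotient.mk
      (Subtype.ext (congrArg (fun f : Module.End ℂ W => f x) S.L0_Lm1))
  L0_act k l v x := by
    obtain ⟨x, rfl⟩ := Submodule.Quotient.mk_surjective _ x
    have bracket := congrArg (fun f : Module.End ℂ W => f x) (S.opShift_bracket ((k : ℤ) - l) v)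
    push_cast at bracket
    exact congrArg Submodule.Quotient.mk (Subtype.ext bracket)
  Lm1_act := S.grLm1_grAct

theorem GrN_isGradedModule (N : ℕ) : (S.GrN N).IsGradedModule :=
  S.isGradedSystem_Gr.isGradedModule_truncData N

end LBGModule

/-! ### Equivalences -/

namespace GradedData

variable {V : Type u} [AddCommGroup V] [Module ℂ V]
variable {N : ℕ} {M M' : Type*} [AddCommGroup M] [Module ℂ M] [AddCommGroup M'] [Module ℂ M']

/-- The linear isomorphism `f` is an equivalence between the graded modules `D` and `D'`. -/
structure IsEquivalence (D : GradedData V N M) (D' : GradedData V N M') (f : M ≃ₗ[ℂ] M') :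
    Prop where
  map_theta : ∀ a w, f (D.theta a w) = D'.theta a (f w)
  map_gr : ∀ n, (D.gr n).map f.toLinearMap = D'.gr n
  map_L0 : ∀ w, f (D.L0 w) = D'.L0 (f w)
  map_Lm1 : ∀ w, f (D.Lm1 w) = D'.Lm1 (f w)

namespace IsEquivalence

variable {D : GradedData V N M} {D' : GradedData V N M'} {f : M ≃ₗ[ℂ] M'}
  (h : IsEquivalence D D' f)

include h

theorem equivalent : D.Equivalent D' := ⟨f, h.map_theta, h.map_gr, h.map_L0, h.map_Lm1⟩

theorem symm : IsEquivalence D' D f.symm where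
  map_theta a w := by rw [LinearEquiv.symm_apply_eq, h.map_theta, LinearEquiv.apply_symm_apply]
  map_gr n := by
    rw [← h.map_gr, ← Submodule.map_comp, LinearEquiv.symm_comp, Submodule.map_id]
  map_L0 w := by rw [LinearEquiv.symm_apply_eq, h.map_L0, LinearEquiv.apply_symm_apply]
  map_Lm1 w := by rw [LinearEquiv.symm_apply_eq, h.map_Lm1, LinearEquiv.apply_symm_apply]

theorem isGradedSubmodule_map {P : Submodule ℂ M} (hP : D.IsGradedSubmodule P) :
    D'.IsGradedSubmodule (P.map f.toLinearMap) where
  theta_mem a := by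
    rintro _ ⟨w, hw, rfl⟩
    exact ⟨_, hP.theta_mem a w hw, h.map_theta a w⟩
  graded := by
    conv_lhs => rw [hP.graded]
    rw [Submodule.map_iSup]
    refine iSup_congr fun n => ?_
    rw [← h.map_gr, Submodule.map_inf _ f.injective]
  L0_mem := by
    rintro _ ⟨w, hw, rfl⟩
    exact ⟨_, hP.L0_mem w hw, h.map_L0 w⟩
  Lm1_mem := by
    rintro _ ⟨w, hw, rfl⟩
    exact ⟨_, hP.Lm1_mem w hw, h.map_Lm1 w⟩

theorem isIrreducibleSub_map {P : Submodule ℂ M} (hP : D.IsIrreducibleSub P) :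
    D'.IsIrreducibleSub (P.map f.toLinearMap) := by
  refine ⟨h.isGradedSubmodule_map hP.1, ?_, fun P' hP' hg => ?_⟩
  · rw [Ne, Submodule.map_eq_bot_iff]
    exact hP.2.1
  · have map_symm_map : (P'.map f.symm.toLinearMap).map f.toLinearMap = P' := by
      rw [← Submodule.map_comp, LinearEquiv.comp_symm, Submodule.map_id]
    have map_symm_le : P'.map f.symm.toLinearMap ≤ P := by
      rintro _ ⟨w', hw', rfl⟩
      obtain ⟨w, hw, rfl⟩ := hP' hw'
      simpa using hw
    refine (hP.2.2 _ map_symm_le (h.symm.isGradedSubmodule_map hg)).imp (fun hbot => ?_)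
      fun heq => ?_
    · rw [← map_symm_map, hbot, Submodule.map_bot]
    · rw [← map_symm_map, heq]

theorem isIrreducible (hD : D.IsIrreducible) : D'.IsIrreducible := by
  have himage := h.isIrreducibleSub_map hD
  rwa [Submodule.map_top, LinearEquiv.range] at himage

theorem isCompletelyReducible (hD : D.IsCompletelyReducible) : D'.IsCompletelyReducible := by
  obtain ⟨𝔇, hirr, hindep, hsup⟩ := hD
  refine ⟨Submodule.map f.toLinearMap '' 𝔇, ?_, ?_, ?_⟩
  · rintro _ ⟨P, hP, rfl⟩
    exact h.isIrreducibleSub_map (hirr P hP)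
  · rw [Set.image_eq_range]
    exact (((sSupIndep_iff _).1 hindep).map_orderIso
      (Submodule.orderIsoMapComap f)).sSupIndep_range
  · have hmap := (Submodule.orderIsoMapComap f).map_sSup 𝔇
    rw [hsup, map_top] at hmap
    rw [sSup_image]
    exact hmap.symm

end IsEquivalence

end GradedData

section SystemEquiv

variable {V : Type u} [AddCommGroup V] [Module ℂ V]
variable {G G' : ℕ → Type u} [∀ n, AddCommGroup (G n)] [∀ n, Module ℂ (G n)]
  [∀ n, AddCommGroup (G' n)] [∀ n, Module ℂ (G' n)]

/-- The degreewise isomorphisms `e n : G n ≃ G' n` are compatible with the actions of `V` and with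
the operators `L(0)` and `L(-1)`. -/
structure IsSystemEquiv (act : ∀ k l : ℕ, V →ₗ[ℂ] G l →ₗ[ℂ] G k) (L0 : ∀ n, Module.End ℂ (G n))
    (Lm1 : ∀ n, G n →ₗ[ℂ] G (n + 1)) (act' : ∀ k l : ℕ, V →ₗ[ℂ] G' l →ₗ[ℂ] G' k)
    (L0' : ∀ n, Module.End ℂ (G' n)) (Lm1' : ∀ n, G' n →ₗ[ℂ] G' (n + 1))
    (e : ∀ n, G n ≃ₗ[ℂ] G' n) : Prop where
  map_act : ∀ k l v x, e k (act k l v x) = act' k l v (e l x)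
  map_L0 : ∀ n x, e n (L0 n x) = L0' n (e n x)
  map_Lm1 : ∀ n x, e (n + 1) (Lm1 n x) = Lm1' n (e n x)

theorem congrLinearEquiv_lof (e : ∀ n, G n ≃ₗ[ℂ] G' n) (n : ℕ) (x : G n) :
    DirectSum.congrLinearEquiv e (DirectSum.lof ℂ ℕ G n x) = DirectSum.lof ℂ ℕ G' n (e n x) :=
  DirectSum.lmap_lof (fun n => (e n).toLinearMap) n x

theorem map_range_lof (e : ∀ n, G n ≃ₗ[ℂ] G' n) (n : ℕ) :
    (LinearMap.range (DirectSum.lof ℂ ℕ G n)).map (DirectSum.congrLinearEquiv e).toLinearMap =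
      LinearMap.range (DirectSum.lof ℂ ℕ G' n) := by
  have comp_lof : (DirectSum.congrLinearEquiv e).toLinearMap ∘ₗ DirectSum.lof ℂ ℕ G n =
      DirectSum.lof ℂ ℕ G' n ∘ₗ (e n).toLinearMap := LinearMap.ext (congrLinearEquiv_lof e n)
  rw [← LinearMap.range_comp, comp_lof,
    LinearMap.range_comp_of_range_eq_top _ (LinearEquiv.range (e n))]

theorem map_upTo (e : ∀ n, G n ≃ₗ[ℂ] G' n) (N : ℕ) :
    (upTo G N).map (DirectSum.congrLinearEquiv e).toLinearMap = upTo G' N := by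
  rw [upTo.eq_1, upTo.eq_1, Submodule.map_iSup]
  exact iSup_congr fun n => map_range_lof e n

/-- The isomorphism `⨁_{n ≤ N} G n ≃ ⨁_{n ≤ N} G' n` induced by isomorphisms `G n ≃ G' n`. -/
def upToEquiv (e : ∀ n, G n ≃ₗ[ℂ] G' n) (N : ℕ) : upTo G N ≃ₗ[ℂ] upTo G' N :=
  (DirectSum.congrLinearEquiv e).ofSubmodules _ _ (map_upTo e N)

theorem upToEquiv_lofUpTo (e : ∀ n, G n ≃ₗ[ℂ] G' n) {N n : ℕ} (hn : n ≤ N) (x : G n) :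
    upToEquiv e N (lofUpTo G hn x) = lofUpTo G' hn (e n x) :=
  Subtype.ext (congrLinearEquiv_lof e n x)

namespace IsSystemEquiv

variable {act : ∀ k l : ℕ, V →ₗ[ℂ] G l →ₗ[ℂ] G k} {L0 : ∀ n, Module.End ℂ (G n)}
  {Lm1 : ∀ n, G n →ₗ[ℂ] G (n + 1)} {act' : ∀ k l : ℕ, V →ₗ[ℂ] G' l →ₗ[ℂ] G' k}
  {L0' : ∀ n, Module.End ℂ (G' n)} {Lm1' : ∀ n, G' n →ₗ[ℂ] G' (n + 1)} {e : ∀ n, G n ≃ₗ[ℂ] G' n}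
  (h : IsSystemEquiv act L0 Lm1 act' L0' Lm1' e)

include h

theorem map_matAct (a : UInf V) (x : ⨁ n, G n) :
    DirectSum.congrLinearEquiv e (matAct act a x) =
      matAct act' a (DirectSum.congrLinearEquiv e x) := by
  suffices (DirectSum.congrLinearEquiv e).toLinearMap ∘ₗ matAct act a =
      matAct act' a ∘ₗ (DirectSum.congrLinearEquiv e).toLinearMap from LinearMap.congr_fun this x
  refine DirectSum.linearMap_ext _ fun l => LinearMap.ext fun x => ?_
  simp only [LinearMap.comp_apply, LinearEquiv.coe_coe]
  rw [congrLinearEquiv_lof, matAct_lof, matAct_lof, map_finsuppSum]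
  exact Finsupp.sum_congr fun k _ => by rw [congrLinearEquiv_lof, h.map_act]

theorem isEquivalence_truncData (N : ℕ) : GradedData.IsEquivalence (truncData N act L0 Lm1)
    (truncData N act' L0' Lm1') (upToEquiv e N) where
  map_theta a w := Subtype.ext (h.map_matAct a.1 w.1)
  map_gr n := by
    have map_comap : ∀ y : upTo G N, (upToEquiv e N y).1 = DirectSum.congrLinearEquiv e y.1 :=
      fun _ => rfl
    ext y
    obtain ⟨y, rfl⟩ := (upToEquiv e N).surjective y
    change _ ∈ Submodule.map (upToEquiv e N).toLinearMap _ ↔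
      (upToEquiv e N y).1 ∈ LinearMap.range (DirectSum.lof ℂ ℕ G' n)
    rw [map_comap, ← map_range_lof e]
    simp [truncData]
  map_L0 w := by
    refine LinearMap.congr_fun (f := (upToEquiv e N).toLinearMap ∘ₗ (truncData N act L0 Lm1).L0)
      (g := (truncData N act' L0' Lm1').L0 ∘ₗ (upToEquiv e N).toLinearMap)
      (upTo_hom_ext fun n hn x => ?_) w
    simp only [LinearMap.comp_apply, LinearEquiv.coe_coe]
    rw [truncData_L0_lofUpTo, upToEquiv_lofUpTo, upToEquiv_lofUpTo, truncData_L0_lofUpTo, h.map_L0]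
  map_Lm1 w := by
    refine LinearMap.congr_fun (f := (upToEquiv e N).toLinearMap ∘ₗ (truncData N act L0 Lm1).Lm1)
      (g := (truncData N act' L0' Lm1').Lm1 ∘ₗ (upToEquiv e N).toLinearMap)
      (upTo_hom_ext fun n hn x => ?_) w
    simp only [LinearMap.comp_apply, LinearEquiv.coe_coe]
    rcases hn.lt_or_eq with hlt | rfl
    · rw [truncData_Lm1_lofUpTo hlt, upToEquiv_lofUpTo, upToEquiv_lofUpTo,
        truncData_Lm1_lofUpTo hlt, h.map_Lm1]
    · rw [upToEquiv_lofUpTo, truncData_Lm1_lofUpTo_top, truncData_Lm1_lofUpTo_top, map_zero]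

theorem isGradedSystem [GradingRestrictedVertexAlgebra V] (h' : IsGradedSystem act' L0' Lm1') :
    IsGradedSystem act L0 Lm1 where
  matAct_eq_zero a ha := by
    refine LinearMap.ext fun x => (DirectSum.congrLinearEquiv e).injective ?_
    rw [h.map_matAct, h'.matAct_eq_zero a ha, LinearMap.zero_apply, LinearMap.zero_apply, map_zero]
  act_diamondEntry k n l u v x := (e k).injective (by simp only [h.map_act, h'.act_diamondEntry])
  act_vac k x := (e k).injective (by rw [h.map_act, h'.act_vac])
  eq_zero_of_act_zero l x hx := (e l).map_eq_zero_iff.1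
    (h'.eq_zero_of_act_zero l _ fun v => by rw [← h.map_act, hx, map_zero])
  exists_spectral_bound := h'.exists_spectral_bound.imp fun _ hB n =>
    biSup_maxGenEigenspace_of_surjective (e n).symm.toLinearMap
      (fun x => by
        rw [LinearEquiv.coe_coe, LinearEquiv.symm_apply_eq, h.map_L0, LinearEquiv.apply_symm_apply])
      (e n).symm.surjective (hB n)
  L0_Lm1 n x := (e (n + 1)).injective (by simp only [map_sub, h.map_L0, h.map_Lm1, h'.L0_Lm1])
  L0_act k l v x := (e k).injective
    (by simp only [map_sub, map_smul, h.map_L0, h.map_act, h'.L0_act])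
  Lm1_act k l v x := (e (k + 1)).injective
    (by simp only [map_sub, h.map_Lm1, h.map_act, h'.Lm1_act])

end IsSystemEquiv

end SystemEquiv

/-! ### Generated submodules and lowest weights -/

theorem mem_of_finsum_mem {ι M σ : Type*} [AddCommGroup M] [SetLike σ M] [AddSubgroupClass σ M]
    {Q : σ} {f : ι → M} (hf : f.support.Finite) (hsum : ∑ᶠ i, f i ∈ Q) {a : ι}
    (hne : ∀ i ≠ a, f i ∈ Q) : f a ∈ Q := by
  have others_mem : ∑ᶠ (i) (_ : i ≠ a), f i ∈ Q :=
    finsum_mem_induction (· ∈ Q) (zero_mem Q) (fun _ _ => add_mem) hne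
  rw [← add_finsum_cond_ne a hf] at hsum
  exact (add_mem_cancel_right others_mem).1 hsum

namespace LBGModule

variable {V : Type u} [AddCommGroup V] [Module ℂ V] [GradingRestrictedVertexAlgebra V]
variable {W : Type u} [AddCommGroup W] [Module ℂ W] (S : LBGModule V W)

theorem vmode_mem_of_opShift_mem {x : W} {Q : Submodule ℂ W} {f : Module.End ℂ W}
    (h : ∀ s v, f (S.opShift s v x) ∈ Q) (v : V) (k : ℤ) : f (vmode S.Y v k x) ∈ Q := by
  induction v using wt_induction with
  | add x y hx hy =>
    rw [vmode_add, LinearMap.add_apply, map_add]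
    exact Q.add_mem hx hy
  | mem d v hv =>
    have hmode := h (d - 1 - k) v
    rwa [S.opShift_of_mem _ hv, sub_sub_cancel] at hmode

-- The expansion of `u_p v_q w` given by the Jacobi identity contains, besides modes of `w`, only
-- products `u_{p-i} v_{q+i} w` with `i > 0`; these vanish once `q + i` is large.
theorem vmode_vmode_mem {Q : Submodule ℂ W} {w : W} (h : ∀ x j, vmode S.Y x j w ∈ Q)
    (u v : V) (p q : ℤ) : vmode S.Y u p (vmode S.Y v q w) ∈ Q := by
  obtain ⟨K, hK⟩ := exists_vmode_eq_zero S.Y u w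
  obtain ⟨L, hL⟩ := exists_vmode_eq_zero S.Y v w
  suffices descent : ∀ (j : ℕ) (p q : ℤ), L - q ≤ j → vmode S.Y u p (vmode S.Y v q w) ∈ Q from
    descent (L - q).toNat p q (by omega)
  intro j
  induction j with
  | zero =>
    intro p q hq
    rw [hL q (by push_cast at hq; omega), map_zero]
    exact Q.zero_mem
  | succ j ih =>
    intro p q hq
    let term : ℕ → W := fun i => ((-1 : ℤ) ^ i * Ring.choose (p - K) i) •
      vmode S.Y u (K + (p - K) - i) (vmode S.Y v (q + i) w)
    have finite_support_term : term.support.Finite := by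
      refine (Set.finite_Iio (L - q).toNat).subset fun i hi => Set.mem_Iio.2 ?_
      by_contra hge
      exact hi (by simp only [term, hL (q + i) (by omega), map_zero, smul_zero])
    have sum_mem : ∑ᶠ i, term i ∈ Q := by
      have jacobi := S.jacobi u v w K q (p - K)
      have mode_eq_zero : ∀ i : ℕ, vmode S.Y u (K + i) w = 0 := fun i => hK _ (by omega)
      simp only [mode_eq_zero, map_zero, smul_zero, sub_zero] at jacobi
      rw [← jacobi]
      exact finsum_induction (· ∈ Q) Q.zero_mem (fun _ _ => Q.add_mem)
        fun i => zsmul_mem (h _ _) _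
    have term_mem : ∀ i ≠ 0, term i ∈ Q := fun i hi =>
      zsmul_mem (ih _ _ (by push_cast at hq; omega)) _
    simpa [term] using mem_of_finsum_mem finite_support_term sum_mem term_mem

/-- The span of the vectors `L(-1)^j v_k a` with `a ∈ A`. -/
def generated (A : Submodule ℂ W) : Submodule ℂ W :=
  Submodule.span ℂ {y | ∃ (j : ℕ) (v : V) (k : ℤ), ∃ a ∈ A, (S.Lm1 ^ j) (vmode S.Y v k a) = y}

theorem mem_generated {A : Submodule ℂ W} {a : W} (ha : a ∈ A) (j : ℕ) (v : V) (k : ℤ) :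
    (S.Lm1 ^ j) (vmode S.Y v k a) ∈ S.generated A :=
  Submodule.subset_span ⟨j, v, k, a, ha, rfl⟩

theorem le_generated (A : Submodule ℂ W) : A ≤ S.generated A := fun a ha => by
  simpa [S.identity] using S.mem_generated ha 0 vac (-1)

theorem map_mem_of_mem_generated {A Q : Submodule ℂ W} {f : Module.End ℂ W}
    (h : ∀ a ∈ A, ∀ (j : ℕ) (v : V) (k : ℤ), f ((S.Lm1 ^ j) (vmode S.Y v k a)) ∈ Q) {x : W}
    (hx : x ∈ S.generated A) : f x ∈ Q := by
  suffices S.generated A ≤ Q.comap f from this hx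
  refine Submodule.span_le.2 ?_
  rintro _ ⟨j, v, k, a, ha, rfl⟩
  exact h a ha j v k

theorem Lm1_mem_generated {A : Submodule ℂ W} {x : W} (hx : x ∈ S.generated A) :
    S.Lm1 x ∈ S.generated A := by
  refine S.map_mem_of_mem_generated (fun a ha j v k => ?_) hx
  rw [← Module.End.mul_apply, ← pow_succ']
  exact S.mem_generated ha (j + 1) v k

theorem vmode_mem_generated {A : Submodule ℂ W} {a : W} (ha : a ∈ A) (v : V) (k : ℤ) (j : ℕ) :
    ∀ (u : V) (p : ℤ), vmode S.Y u p ((S.Lm1 ^ j) (vmode S.Y v k a)) ∈ S.generated A := by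
  induction j with
  | zero =>
    intro u p
    exact S.vmode_vmode_mem (fun x j => S.mem_generated ha 0 x j) u v p k
  | succ j ih =>
    intro u p
    rw [pow_succ', Module.End.mul_apply]
    have bracket := congrArg (fun f : Module.End ℂ W => f ((S.Lm1 ^ j) (vmode S.Y v k a)))
      (S.Lm1_bracket u p)
    simp only [LinearMap.sub_apply, Module.End.mul_apply] at bracket
    rw [← sub_sub_self (S.Lm1 _) (vmode S.Y u p _), bracket]
    exact Submodule.sub_mem _ (S.Lm1_mem_generated (ih u p)) (ih _ p)

theorem L0_mem_generated {A : Submodule ℂ W} (hA : ∀ a ∈ A, S.L0 a ∈ A) {a : W} (ha : a ∈ A)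
    (v : V) (k : ℤ) (j : ℕ) : S.L0 ((S.Lm1 ^ j) (vmode S.Y v k a)) ∈ S.generated A := by
  induction j with
  | zero =>
    have bracket := congrArg (fun f : Module.End ℂ W => f a) (S.L0_bracket v k)
    simp only [LinearMap.sub_apply, Module.End.mul_apply, LinearMap.smul_apply] at bracket
    rw [pow_zero, Module.End.one_apply, ← sub_add_cancel (S.L0 _) (vmode S.Y v k (S.L0 a)),
      bracket]
    exact Submodule.add_mem _ (Submodule.sub_mem _ (S.mem_generated ha 0 _ k)
      (Submodule.smul_mem _ _ (S.mem_generated ha 0 v k))) (S.mem_generated (hA a ha) 0 v k)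
  | succ j ih =>
    rw [pow_succ', Module.End.mul_apply]
    have bracket := congrArg (fun f : Module.End ℂ W => f ((S.Lm1 ^ j) (vmode S.Y v k a))) S.L0_Lm1
    simp only [LinearMap.sub_apply, Module.End.mul_apply] at bracket
    rw [← sub_add_cancel (S.L0 _) (S.Lm1 (S.L0 _)), bracket]
    exact Submodule.add_mem _ (S.Lm1_mem_generated (S.mem_generated ha j v k))
      (S.Lm1_mem_generated ih)

theorem generated_isSubmodule {A : Submodule ℂ W} (hA : ∀ a ∈ A, S.L0 a ∈ A) :
    S.IsSubmodule (S.generated A) where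
  mode_mem u p _ hx :=
    S.map_mem_of_mem_generated (fun _ ha j v k => S.vmode_mem_generated ha v k j u p) hx
  L0_mem _ hx := S.map_mem_of_mem_generated (fun _ ha j v k => S.L0_mem_generated hA ha v k j) hx
  Lm1_mem _ hx := S.Lm1_mem_generated hx

theorem generated_le {A Q : Submodule ℂ W}
    (h : ∀ a ∈ A, ∀ (j : ℕ) (s : ℤ) (v : V), (S.Lm1 ^ j) (S.opShift s v a) ∈ Q) :
    S.generated A ≤ Q := by
  refine Submodule.span_le.2 ?_
  rintro _ ⟨j, v, k, a, ha, rfl⟩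
  exact S.vmode_mem_of_opShift_mem (h a ha j) v k

theorem Lm1_pow_mem {P : Submodule ℂ W} (hP : S.IsSubmodule P) {x : W} (hx : x ∈ P) (j : ℕ) :
    (S.Lm1 ^ j) x ∈ P := by
  induction j with
  | zero => simpa using hx
  | succ j ih =>
    rw [pow_succ', Module.End.mul_apply]
    exact hP.Lm1_mem _ ih

theorem generated_eq_of_isIrreducibleSub {P A : Submodule ℂ W} (hP : S.IsIrreducibleSub P)
    (hAP : A ≤ P) (hA : ∀ a ∈ A, S.L0 a ∈ A) (hne : A ≠ ⊥) : S.generated A = P := by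
  refine (hP.2.2 _ (S.generated_le fun a ha j s v => ?_) (S.generated_isSubmodule hA)).resolve_left
    fun hbot => hne (le_bot_iff.1 (hbot ▸ S.le_generated A))
  exact S.Lm1_pow_mem hP.1 (S.opShift_mem_sub s v P hP.1 a (hAP ha)) j

theorem Lm1_pow_mem_maxGenEigenspace {μ : ℂ} {x : W} (hx : x ∈ S.L0.maxGenEigenspace μ) (j : ℕ) :
    (S.Lm1 ^ j) x ∈ S.L0.maxGenEigenspace (μ + j) := by
  induction j with
  | zero => simpa using hx
  | succ j ih =>
    rw [pow_succ', Module.End.mul_apply, Nat.cast_succ, ← add_assoc]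
    exact S.maxGen_shift (s := 1) (by simpa using S.L0_Lm1) _ _ ih

theorem opShift_mem_maxGenEigenspace {μ : ℂ} {x : W} (hx : x ∈ S.L0.maxGenEigenspace μ) (s : ℤ)
    (v : V) : S.opShift s v x ∈ S.L0.maxGenEigenspace (μ + s) :=
  S.maxGen_shift (S.opShift_bracket s v) _ _ hx

theorem mem_of_inf_maxGenEigenspace_ne_bot {P : Submodule ℂ W} {s : Set ℂ}
    (h : P ≤ ⨆ μ ∈ s, S.L0.maxGenEigenspace μ) {ν : ℂ} (hν : P ⊓ S.L0.maxGenEigenspace ν ≠ ⊥) :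
    ν ∈ s := by
  by_contra hνs
  have disjoint := S.L0.independent_maxGenEigenspace.disjoint_biSup hνs
  exact hν (disjoint_self.1 (disjoint.mono inf_le_right (inf_le_left.trans h)))

variable {S}

theorem IsLowestWeight.le_biSup {P : Submodule ℂ W} {h : ℂ} (hP : S.IsLowestWeight P h) :
    P ≤ ⨆ μ ∈ Set.range (fun n : ℕ => h + n), S.L0.maxGenEigenspace μ := by
  conv_lhs => rw [hP.2.1]
  exact iSup_le fun n => inf_le_right.trans
    (le_iSup₂_of_le (f := fun μ _ => S.L0.maxGenEigenspace μ) _ ⟨n, rfl⟩ le_rfl)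

theorem IsLowestWeight.unique {P : Submodule ℂ W} {h h' : ℂ} (hP : S.IsLowestWeight P h)
    (hP' : S.IsLowestWeight P h') : h = h' := by
  obtain ⟨n, hn : h' + n = h⟩ := S.mem_of_inf_maxGenEigenspace_ne_bot hP'.le_biSup hP.2.2
  obtain ⟨m, hm : h + m = h'⟩ := S.mem_of_inf_maxGenEigenspace_ne_bot hP.le_biSup hP'.2.2
  have sum_eq_zero : ((n + m : ℕ) : ℂ) = 0 := by
    push_cast
    linear_combination hn + hm
  have n_eq_zero : n = 0 := (Nat.add_eq_zero_iff.1 (Nat.cast_eq_zero.1 sum_eq_zero)).1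
  rw [← hn, n_eq_zero, Nat.cast_zero, add_zero]

theorem IsLowestWeight.inf_eq_bot {P : Submodule ℂ W} {h : ℂ} (hP : S.IsLowestWeight P h) {s : ℤ}
    (hs : s < 0) : P ⊓ S.L0.maxGenEigenspace (h + s) = ⊥ := by
  by_contra hne
  obtain ⟨n, hn⟩ := S.mem_of_inf_maxGenEigenspace_ne_bot hP.le_biSup hne
  have cast_eq : ((n : ℤ) : ℂ) = s := by
    push_cast
    exact add_left_cancel hn
  have n_eq : (n : ℤ) = s := Int.cast_injective cast_eq
  omega

theorem IsLowestWeight.inf_le_Omega {P : Submodule ℂ W} {h : ℂ} (hP : S.IsLowestWeight P h)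
    (n : ℕ) : P ⊓ S.L0.maxGenEigenspace (h + n) ≤ S.Omega n := by
  rintro w ⟨hwP, hwn⟩ d k v hv hk
  have mode_mem : vmode S.Y v k w ∈
      P ⊓ S.L0.maxGenEigenspace (h + ((n + (d - 1 - k) : ℤ) : ℂ)) := by
    refine ⟨hP.1.mode_mem v k w hwP, ?_⟩
    have hshift := S.opShift_mem_maxGenEigenspace hwn (d - 1 - k) v
    rw [S.opShift_of_mem _ hv, sub_sub_cancel, add_assoc] at hshift
    push_cast at hshift ⊢
    exact hshift
  rw [hP.inf_eq_bot (by omega)] at mode_mem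
  exact mode_mem

-- A vector of `Ω_n` in degree `m > n` generates a submodule without the lowest weight `h`.
theorem IsIrreducibleSub.inf_Omega_eq_bot {P : Submodule ℂ W} (hirr : S.IsIrreducibleSub P)
    {h : ℂ} (hP : S.IsLowestWeight P h) {n : ℤ} {m : ℕ} (hnm : n < m) :
    P ⊓ S.L0.maxGenEigenspace (h + m) ⊓ S.Omega n = ⊥ := by
  set A := P ⊓ S.L0.maxGenEigenspace (h + m) ⊓ S.Omega n
  by_contra hne
  have L0_mem : ∀ a ∈ A, S.L0 a ∈ A := fun a ha =>
    ⟨⟨hP.1.L0_mem a ha.1.1, S.L0.mapsTo_maxGenEigenspace_of_comm rfl _ ha.1.2⟩,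
      by simpa using S.L0_mem_Omega n a ha.2⟩
  have generated_eq : S.generated A = P :=
    S.generated_eq_of_isIrreducibleSub hirr (inf_le_left.trans inf_le_left) L0_mem hne
  have generated_le : S.generated A ≤ ⨆ μ ∈ {μ : ℂ | μ ≠ h}, S.L0.maxGenEigenspace μ := by
    refine S.generated_le fun a ha j s v => ?_
    rcases lt_or_ge s (-n) with hs | hs
    · rw [S.opShift_eq_zero_of_mem_Omega hs ha.2, map_zero]
      exact Submodule.zero_mem _
    · refine Submodule.mem_iSup_of_mem _ (Submodule.mem_iSup_of_mem (fun heq => ?_)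
        (S.Lm1_pow_mem_maxGenEigenspace (S.opShift_mem_maxGenEigenspace ha.1.2 s v) j))
      have cast_eq_zero : ((m + s + j : ℤ) : ℂ) = 0 := by
        push_cast
        linear_combination heq
      have sum_eq_zero : (m + s + j : ℤ) = 0 := Int.cast_eq_zero.1 cast_eq_zero
      omega
  exact S.mem_of_inf_maxGenEigenspace_ne_bot (generated_eq.ge.trans generated_le) hP.2.2 rfl

variable (S) in
theorem map_mem_iSup_int {P : Submodule ℂ W} {f : Module.End ℂ W} {s : ℤ}
    (hf : S.L0 * f - f * S.L0 = (s : ℂ) • f) (hfP : ∀ w ∈ P, f w ∈ P) {μ : ℂ} {w : W}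
    (hw : w ∈ ⨆ n : ℤ, P ⊓ S.L0.maxGenEigenspace (μ + n)) :
    f w ∈ ⨆ n : ℤ, P ⊓ S.L0.maxGenEigenspace (μ + n) := by
  suffices (⨆ n : ℤ, P ⊓ S.L0.maxGenEigenspace (μ + n)) ≤
    (⨆ n : ℤ, P ⊓ S.L0.maxGenEigenspace (μ + n)).comap f from this hw
  refine iSup_le fun n w hw => Submodule.mem_iSup_of_mem (n + s) ⟨hfP w hw.1, ?_⟩
  rw [Int.cast_add, ← add_assoc]
  exact S.maxGen_shift hf _ w hw.2

theorem IsSubmodule.iSup_int {P : Submodule ℂ W} (hP : S.IsSubmodule P) (μ : ℂ) :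
    S.IsSubmodule (⨆ n : ℤ, P ⊓ S.L0.maxGenEigenspace (μ + n)) where
  mode_mem v k _ hw := S.vmode_mem_of_opShift_mem (f := 1) (fun s v =>
    S.map_mem_iSup_int (S.opShift_bracket s v) (S.opShift_mem_sub s v P hP) hw) v k
  L0_mem _ hw := S.map_mem_iSup_int (s := 0) (by simp) hP.L0_mem hw
  Lm1_mem _ hw := S.map_mem_iSup_int (s := 1) (by simpa using S.L0_Lm1) hP.Lm1_mem hw

variable (S) in
theorem exists_inf_maxGenEigenspace_ne_bot {P : Submodule ℂ W} (hP : ∀ w ∈ P, S.L0 w ∈ P)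
    (hne : P ≠ ⊥) : ∃ μ, P ⊓ S.L0.maxGenEigenspace μ ≠ ⊥ := by
  by_contra! hall
  refine hne (le_bot_iff.1 ((le_iSup_inf_maxGenEigenspace hP Set.univ ?_).trans ?_))
  · simp [S.graded]
  · simp [hall]

theorem IsIrreducibleSub.iSup_int_eq {P : Submodule ℂ W} (hP : S.IsIrreducibleSub P) {μ : ℂ}
    (hμ : P ⊓ S.L0.maxGenEigenspace μ ≠ ⊥) :
    ⨆ n : ℤ, P ⊓ S.L0.maxGenEigenspace (μ + n) = P := by
  refine (hP.2.2 _ (iSup_le fun _ => inf_le_left) (hP.1.iSup_int μ)).resolve_left fun hbot => ?_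
  rw [iSup_eq_bot] at hbot
  exact hμ (by simpa using hbot 0)

variable (S) in
theorem exists_least_weight {P : Submodule ℂ W} {μ : ℂ}
    (hμ : P ⊓ S.L0.maxGenEigenspace μ ≠ ⊥) :
    ∃ m : ℤ, P ⊓ S.L0.maxGenEigenspace (μ + m) ≠ ⊥ ∧
      ∀ n : ℤ, P ⊓ S.L0.maxGenEigenspace (μ + n) ≠ ⊥ → m ≤ n := by
  obtain ⟨B, hB⟩ := S.bounded
  refine Int.exists_least_of_bdd ⟨⌊B - μ.re⌋, fun n hn => ?_⟩ ⟨0, by simpa using hμ⟩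
  by_contra! hlt
  refine hn (le_bot_iff.1 (inf_le_right.trans (hB _ ?_).le))
  have n_lt : (n : ℝ) < B - μ.re := (Int.cast_lt.2 hlt).trans_le (Int.floor_le _)
  rw [Complex.add_re, Complex.intCast_re]
  linarith

theorem IsIrreducibleSub.exists_isLowestWeight {P : Submodule ℂ W} (hP : S.IsIrreducibleSub P) :
    ∃ h, S.IsLowestWeight P h := by
  obtain ⟨μ, hμ⟩ := S.exists_inf_maxGenEigenspace_ne_bot hP.1.L0_mem hP.2.1
  obtain ⟨m, hm, hmin⟩ := S.exists_least_weight hμ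
  refine ⟨μ + m, hP.1, le_antisymm ?_ (iSup_le fun _ => inf_le_left), hm⟩
  conv_lhs => rw [← hP.iSup_int_eq hμ]
  refine iSup_le fun n => ?_
  by_cases hn : P ⊓ S.L0.maxGenEigenspace (μ + n) = ⊥
  · exact hn.le.trans bot_le
  · obtain ⟨j, rfl⟩ := Int.le.dest (hmin n hn)
    refine le_iSup_of_le j (le_of_eq ?_)
    push_cast
    rw [add_assoc]

end LBGModule

/-! ### Decompositions into irreducible submodules -/

section InternalProj

variable {R ι M : Type*} [Ring R] [DecidableEq ι] [AddCommGroup M] [Module R M]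
variable {p : ι → Submodule R M} (hp : DirectSum.IsInternal p)

/-- The projection of `M` onto the summand `p i` of an internal direct sum, as an endomorphism
of `M`. -/
def internalProj (i : ι) : Module.End R M :=
  (p i).subtype ∘ₗ DirectSum.component R ι (fun i => p i) i ∘ₗ
    (LinearEquiv.ofBijective (DirectSum.coeLinearMap p) hp).symm.toLinearMap

theorem internalProj_mem (i : ι) (x : M) : internalProj hp i x ∈ p i := Subtype.coe_prop _

theorem internalProj_of_mem {i : ι} {x : M} (hx : x ∈ p i) : internalProj hp i x = x :=
  congrArg Subtype.val (hp.ofBijective_coeLinearMap_same ⟨x, hx⟩)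

theorem internalProj_of_mem_ne {i j : ι} (hij : i ≠ j) {x : M} (hx : x ∈ p i) :
    internalProj hp j x = 0 :=
  congrArg Subtype.val (hp.ofBijective_coeLinearMap_of_ne hij ⟨x, hx⟩)

theorem mem_of_internalProj_mem {q : Submodule R M} {x : M} (h : ∀ i, internalProj hp i x ∈ q) :
    x ∈ q := by
  obtain ⟨y, rfl⟩ := hp.surjective x
  classical
  change DirectSum.coeLinearMap p y ∈ q
  rw [DirectSum.coeLinearMap_eq_dfinsuppSum]
  refine Submodule.dfinsuppSum_mem _ _ _ fun i _ => ?_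
  have proj_eq : internalProj hp i (DirectSum.coeLinearMap p y) = y i :=
    congrArg (fun z : ⨁ i, p i => (z i : M))
      ((LinearEquiv.ofBijective (DirectSum.coeLinearMap p) hp).symm_apply_apply y)
  exact proj_eq ▸ h i

theorem internalProj_apply_comm {f : Module.End R M} (hf : ∀ i, ∀ x ∈ p i, f x ∈ p i) (i : ι)
    (x : M) : internalProj hp i (f x) = f (internalProj hp i x) := by
  suffices (⊤ : Submodule R M) ≤
    LinearMap.eqLocus (internalProj hp i ∘ₗ f) (f ∘ₗ internalProj hp i) from this trivial
  rw [← hp.submodule_iSup_eq_top]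
  refine iSup_le fun j y hy => ?_
  rw [LinearMap.mem_eqLocus, LinearMap.comp_apply, LinearMap.comp_apply]
  rcases eq_or_ne j i with rfl | hji
  · rw [internalProj_of_mem hp hy, internalProj_of_mem hp (hf j y hy)]
  · rw [internalProj_of_mem_ne hp hji hy, internalProj_of_mem_ne hp hji (hf j y hy), map_zero]

end InternalProj

namespace LBGModule

variable {V : Type u} [AddCommGroup V] [Module ℂ V] [GradingRestrictedVertexAlgebra V]
variable {W : Type u} [AddCommGroup W] [Module ℂ W] {S : LBGModule V W}
variable {𝔇 : Set (Submodule ℂ W)}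

theorem IsLowestWeight.inf_le_GSub {P : Submodule ℂ W} (hP : P ∈ 𝔇) {h : ℂ}
    (hh : S.IsLowestWeight P h) (n : ℕ) : P ⊓ S.L0.maxGenEigenspace (h + n) ≤ S.GSub 𝔇 n :=
  le_iSup₂_of_le P hP (le_iSup₂_of_le h hh le_rfl)

variable (S 𝔇) in
theorem GSub_le_Omega (n : ℕ) : S.GSub 𝔇 n ≤ S.Omega n :=
  iSup₂_le fun _ _ => iSup₂_le fun _ hh => hh.inf_le_Omega n

variable (S 𝔇) in
/-- The canonical map `G_n(W) → Gr_n(W)`. -/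
def toGr (n : ℕ) : S.GSub 𝔇 n →ₗ[ℂ] S.Gr n :=
  Submodule.mkQ _ ∘ₗ Submodule.inclusion (S.GSub_le_Omega 𝔇 n)

theorem IsIrreducible.isDecomposition (h : S.IsIrreducible) : S.IsDecomposition {⊤} :=
  ⟨by rintro _ rfl; exact h, sSupIndep_singleton _, sSup_singleton⟩

namespace IsDecomposition

variable (h𝔇 : S.IsDecomposition 𝔇)
include h𝔇

theorem isInternal [DecidableEq 𝔇] : DirectSum.IsInternal (fun P : 𝔇 => (P : Submodule ℂ W)) :=
  DirectSum.isInternal_submodule_of_iSupIndep_of_iSup_eq_top ((sSupIndep_iff _).1 h𝔇.2.1)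
    (by rw [← sSup_eq_iSup', h𝔇.2.2])

theorem isSubmodule {P : Submodule ℂ W} (hP : P ∈ 𝔇) : S.IsSubmodule P := (h𝔇.1 P hP).1

theorem exists_isLowestWeight (P : 𝔇) : ∃ h, S.IsLowestWeight P.1 h :=
  (h𝔇.1 P.1 P.2).exists_isLowestWeight

theorem iSup_GSub : ⨆ n, S.GSub 𝔇 n = ⊤ := by
  rw [← top_le_iff, ← h𝔇.2.2]
  refine sSup_le fun P hP => ?_
  obtain ⟨h, hh⟩ := h𝔇.exists_isLowestWeight ⟨P, hP⟩
  conv_lhs => rw [show P = _ from hh.2.1]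
  exact iSup_mono (hh.inf_le_GSub hP)

open scoped Classical in
theorem internalProj_mem_Omega (P : 𝔇) {n : ℤ} {w : W} (hw : w ∈ S.Omega n) :
    internalProj h𝔇.isInternal P w ∈ S.Omega n := fun d k v hv hk => by
  rw [← internalProj_apply_comm h𝔇.isInternal
    (fun Q => (h𝔇.isSubmodule Q.2).mode_mem v k), hw d k v hv hk, map_zero]

open scoped Classical in
theorem internalProj_mem_of_mem_GSub {P : 𝔇} {h : ℂ} (hh : S.IsLowestWeight P.1 h) {n : ℕ} {w : W}
    (hw : w ∈ S.GSub 𝔇 n) :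
    internalProj h𝔇.isInternal P w ∈ P.1 ⊓ S.L0.maxGenEigenspace (h + n) := by
  suffices S.GSub 𝔇 n ≤ (P.1 ⊓ S.L0.maxGenEigenspace (h + n)).comap
    (internalProj h𝔇.isInternal P) from this hw
  refine iSup₂_le fun Q hQ => iSup₂_le fun h' hh' x hx => ?_
  rw [Submodule.mem_comap]
  rcases eq_or_ne ⟨Q, hQ⟩ P with rfl | hQP
  · rw [internalProj_of_mem h𝔇.isInternal (i := ⟨Q, hQ⟩) hx.1, hh.unique hh']
    exact hx
  · rw [internalProj_of_mem_ne h𝔇.isInternal hQP hx.1]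
    exact Submodule.zero_mem _

theorem iSupIndep_GSub : iSupIndep (S.GSub 𝔇) := by
  classical
  intro n
  rw [Submodule.disjoint_def]
  intro w hwn hw
  rw [← Submodule.mem_bot ℂ]
  refine mem_of_internalProj_mem h𝔇.isInternal fun P => ?_
  obtain ⟨h, hh⟩ := h𝔇.exists_isLowestWeight P
  have proj_mem : internalProj h𝔇.isInternal P w ∈
      ⨆ (m : ℕ) (_ : m ≠ n), S.L0.maxGenEigenspace (h + m) := by
    suffices (⨆ (m : ℕ) (_ : m ≠ n), S.GSub 𝔇 m) ≤ Submodule.comap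
      (internalProj h𝔇.isInternal P) (⨆ (m : ℕ) (_ : m ≠ n), S.L0.maxGenEigenspace (h + m))
      from this hw
    exact iSup₂_le fun m hm x hx => Submodule.mem_iSup_of_mem m
      (Submodule.mem_iSup_of_mem hm (h𝔇.internalProj_mem_of_mem_GSub hh hx).2)
  have independent : iSupIndep fun m : ℕ => S.L0.maxGenEigenspace (h + m) :=
    S.L0.independent_maxGenEigenspace.comp ((add_right_injective h).comp Nat.cast_injective)
  exact (independent n).le_bot ⟨(h𝔇.internalProj_mem_of_mem_GSub hh hwn).2, proj_mem⟩

theorem isInternal_GSub : DirectSum.IsInternal (S.GSub 𝔇) :=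
  DirectSum.isInternal_submodule_of_iSupIndep_of_iSup_eq_top h𝔇.iSupIndep_GSub h𝔇.iSup_GSub

theorem GSub_inf_Omega {n : ℤ} {m : ℕ} (hnm : n < m) : S.GSub 𝔇 m ⊓ S.Omega n = ⊥ := by
  classical
  rw [eq_bot_iff]
  rintro w ⟨hwm, hwn⟩
  refine mem_of_internalProj_mem h𝔇.isInternal fun P => ?_
  obtain ⟨h, hh⟩ := h𝔇.exists_isLowestWeight P
  rw [← (h𝔇.1 P.1 P.2).inf_Omega_eq_bot hh hnm]
  exact ⟨h𝔇.internalProj_mem_of_mem_GSub hh hwm, h𝔇.internalProj_mem_Omega P hwn⟩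

theorem inf_Omega_le {P : Submodule ℂ W} (hP : P ∈ 𝔇) (n : ℕ) :
    P ⊓ S.Omega n ≤ S.GSub 𝔇 n ⊔ S.Omega ((n : ℤ) - 1) := by
  obtain ⟨h, hh⟩ := h𝔇.exists_isLowestWeight ⟨P, hP⟩
  have L0_mem : ∀ w ∈ P ⊓ S.Omega n, S.L0 w ∈ P ⊓ S.Omega n := fun w hw =>
    ⟨hh.1.L0_mem w hw.1, by simpa using S.L0_mem_Omega n w hw.2⟩
  refine (le_iSup_inf_maxGenEigenspace L0_mem _ (inf_le_left.trans hh.le_biSup)).trans ?_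
  rw [iSup_range]
  refine iSup_le fun m => ?_
  rw [inf_right_comm]
  rcases lt_trichotomy m n with hm | rfl | hm
  · exact le_sup_of_le_right (inf_le_left.trans ((hh.inf_le_Omega m).trans
      (S.Omega_mono (by omega))))
  · exact le_sup_of_le_left (inf_le_left.trans (hh.inf_le_GSub hP m))
  · rw [(h𝔇.1 P hP).inf_Omega_eq_bot hh (by exact_mod_cast hm)]
    exact bot_le

theorem Omega_le (n : ℕ) : S.Omega n ≤ S.GSub 𝔇 n ⊔ S.Omega ((n : ℤ) - 1) := by
  classical
  exact fun w hw => mem_of_internalProj_mem h𝔇.isInternal fun P => h𝔇.inf_Omega_le P.2 n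
    ⟨internalProj_mem h𝔇.isInternal P w, h𝔇.internalProj_mem_Omega P hw⟩

theorem toGr_injective (n : ℕ) : Function.Injective (S.toGr 𝔇 n) := by
  refine (injective_iff_map_eq_zero _).2 fun x hx => Subtype.ext ?_
  have mem_inf : (x : W) ∈ S.GSub 𝔇 n ⊓ S.Omega ((n : ℤ) - 1) := ⟨x.2, S.Gr_mk_eq_zero.1 hx⟩
  rwa [h𝔇.GSub_inf_Omega (by omega)] at mem_inf

theorem toGr_surjective (n : ℕ) : Function.Surjective (S.toGr 𝔇 n) := by
  intro y
  obtain ⟨y, rfl⟩ := Submodule.Quotient.mk_surjective _ y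
  obtain ⟨g, hg, o, ho, hgo⟩ := Submodule.mem_sup.1 (h𝔇.Omega_le n y.2)
  refine ⟨⟨g, hg⟩, (Submodule.Quotient.eq _).2 ?_⟩
  change g - (y : W) ∈ S.Omega ((n : ℤ) - 1)
  rw [← hgo, sub_add_cancel_left]
  exact Submodule.neg_mem _ ho

/-- The canonical isomorphism `G_n(W) ≃ Gr_n(W)`. -/
def grEquiv (n : ℕ) : S.GSub 𝔇 n ≃ₗ[ℂ] S.Gr n :=
  LinearEquiv.ofBijective (S.toGr 𝔇 n) ⟨h𝔇.toGr_injective n, h𝔇.toGr_surjective n⟩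

theorem isSystemEquiv_grEquiv : IsSystemEquiv (S.GSubAct 𝔇)
    (fun n => S.L0.restrict (S.L0_mem_GSub 𝔇 n)) (fun n => S.Lm1.restrict (S.Lm1_mem_GSub 𝔇 n))
    S.grAct S.grL0 S.grLm1 h𝔇.grEquiv where
  map_act _ _ _ _ := rfl
  map_L0 _ _ := rfl
  map_Lm1 _ _ := rfl

theorem isEquivalence_TN_GrN (N : ℕ) :
    GradedData.IsEquivalence (S.TN 𝔇 N) (S.GrN N) (upToEquiv h𝔇.grEquiv N) :=
  h𝔇.isSystemEquiv_grEquiv.isEquivalence_truncData N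

theorem TN_isGradedModule (N : ℕ) : (S.TN 𝔇 N).IsGradedModule :=
  (h𝔇.isSystemEquiv_grEquiv.isGradedSystem S.isGradedSystem_Gr).isGradedModule_truncData N

end IsDecomposition

end LBGModule

/-! ### Irreducible graded submodules -/

section System

variable {V : Type u} [AddCommGroup V] [Module ℂ V]
variable {G : ℕ → Type u} [∀ n, AddCommGroup (G n)] [∀ n, Module ℂ (G n)]

theorem lof_apply_mem {Q : ∀ n, Submodule ℂ (G n)} {n : ℕ} {y : G n} (hy : y ∈ Q n) (m : ℕ) :
    DirectSum.lof ℂ ℕ G n y m ∈ Q m := by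
  rcases eq_or_ne n m with rfl | hnm
  · rwa [DirectSum.lof_apply]
  · rw [DirectSum.lof_eq_of, DirectSum.of_eq_of_ne _ _ _ hnm.symm]
    exact Submodule.zero_mem _

theorem mem_of_lofUpTo_component_mem {N : ℕ} {X : Submodule ℂ (upTo G N)} {x : upTo G N}
    (h : ∀ n (hn : n ≤ N), lofUpTo G hn (x.1 n) ∈ X) : x ∈ X := by
  classical
  suffices x.1 ∈ X.map (upTo G N).subtype by
    obtain ⟨y, hy, hyx⟩ := this
    rwa [← Subtype.ext hyx]
  rw [← DirectSum.sum_support_of x.1]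
  refine Submodule.sum_mem _ fun n _ => ?_
  rcases le_or_gt n N with hn | hn
  · exact ⟨_, h n hn, rfl⟩
  · rw [component_eq_zero_of_mem_upTo hn x.2, map_zero]
    exact Submodule.zero_mem _

/-- The subspace `⨁_{n ≤ N} Q n` of `⨁_{n ≤ N} G n`. -/
def truncSub (Q : ∀ n, Submodule ℂ (G n)) (N : ℕ) : Submodule ℂ (upTo G N) :=
  ⨅ n, (Q n).comap (DirectSum.component ℂ ℕ G n ∘ₗ (upTo G N).subtype)

variable {Q : ∀ n, Submodule ℂ (G n)} {N : ℕ}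

theorem mem_truncSub {x : upTo G N} : x ∈ truncSub Q N ↔ ∀ n, x.1 n ∈ Q n :=
  Submodule.mem_iInf _

theorem lofUpTo_mem_truncSub {n : ℕ} (hn : n ≤ N) {y : G n} :
    lofUpTo G hn y ∈ truncSub Q N ↔ y ∈ Q n := by
  refine ⟨fun h => ?_, fun hy => mem_truncSub.2 (lof_apply_mem hy)⟩
  rw [← lofUpTo_apply_self hn y]
  exact mem_truncSub.1 h n

theorem map_mem_truncSub {f : Module.End ℂ (upTo G N)}
    (h : ∀ n (hn : n ≤ N), ∀ y ∈ Q n, f (lofUpTo G hn y) ∈ truncSub Q N) {x : upTo G N}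
    (hx : x ∈ truncSub Q N) : f x ∈ truncSub Q N :=
  mem_of_lofUpTo_component_mem (X := (truncSub Q N).comap f)
    fun n hn => h n hn _ (mem_truncSub.1 hx n)

theorem matAct_lof_apply_mem {act : ∀ k l : ℕ, V →ₗ[ℂ] G l →ₗ[ℂ] G k}
    (hact : ∀ k l v, ∀ y ∈ Q l, act k l v y ∈ Q k) (a : UInf V) {l : ℕ} {y : G l} (hy : y ∈ Q l)
    (m : ℕ) : matAct act a (DirectSum.lof ℂ ℕ G l y) m ∈ Q m := by
  suffices matAct act a (DirectSum.lof ℂ ℕ G l y) ∈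
    (Q m).comap (DirectSum.component ℂ ℕ G m) from this
  rw [matAct_lof]
  exact AddSubmonoidClass.finsuppSum_mem _ _ _ fun k _ => lof_apply_mem (hact k l _ y hy) m

theorem truncSub_isGradedSubmodule [GradingRestrictedVertexAlgebra V]
    {act : ∀ k l : ℕ, V →ₗ[ℂ] G l →ₗ[ℂ] G k}
    {L0 : ∀ n, Module.End ℂ (G n)} {Lm1 : ∀ n, G n →ₗ[ℂ] G (n + 1)}
    (hact : ∀ k l v, ∀ y ∈ Q l, act k l v y ∈ Q k) (hL0 : ∀ n, ∀ y ∈ Q n, L0 n y ∈ Q n)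
    (hLm1 : ∀ n, ∀ y ∈ Q n, Lm1 n y ∈ Q (n + 1)) :
    (truncData N act L0 Lm1).IsGradedSubmodule (truncSub Q N) where
  theta_mem a _ hx := map_mem_truncSub
    (fun _ _ _ hy => mem_truncSub.2 (matAct_lof_apply_mem hact a.1 hy)) hx
  graded := by
    refine le_antisymm (fun x hx => ?_) (iSup_le fun n => inf_le_left)
    exact mem_of_lofUpTo_component_mem fun n hn => Submodule.mem_iSup_of_mem n
      ⟨(lofUpTo_mem_truncSub hn).2 (mem_truncSub.1 hx n), lofUpTo_mem_gr hn _⟩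
  L0_mem _ hx := by
    refine map_mem_truncSub (fun n hn y hy => ?_) hx
    rw [truncData_L0_lofUpTo]
    exact (lofUpTo_mem_truncSub hn).2 (hL0 n y hy)
  Lm1_mem _ hx := by
    refine map_mem_truncSub (fun n hn y hy => ?_) hx
    rcases hn.lt_or_eq with hlt | rfl
    · rw [truncData_Lm1_lofUpTo hlt]
      exact (lofUpTo_mem_truncSub _).2 (hLm1 n y hy)
    · rw [truncData_Lm1_lofUpTo_top]
      exact Submodule.zero_mem _

end System

namespace LBGModule

variable {V : Type u} [AddCommGroup V] [Module ℂ V] [GradingRestrictedVertexAlgebra V]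
variable {W : Type u} [AddCommGroup W] [Module ℂ W] {S : LBGModule V W}
variable {𝔇 : Set (Submodule ℂ W)} {N : ℕ}

variable (S 𝔇 N) in
/-- The subspace `T_N(P)` of `T_N(W)`: vectors with all components in the submodule `P`. -/
def TNSub (P : Submodule ℂ W) : Submodule ℂ (upTo (fun n => S.GSub 𝔇 n) N) :=
  truncSub (fun n => P.comap (S.GSub 𝔇 n).subtype) N

theorem TNSub_isGradedSubmodule {P : Submodule ℂ W} (hP : S.IsSubmodule P) :
    (S.TN 𝔇 N).IsGradedSubmodule (S.TNSub 𝔇 N P) :=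
  truncSub_isGradedSubmodule (fun _ _ _ _ hy => S.opShift_mem_sub _ _ P hP _ hy)
    (fun _ _ hy => hP.L0_mem _ hy) fun _ _ hy => hP.Lm1_mem _ hy

theorem TNSub_top : S.TNSub 𝔇 N ⊤ = ⊤ := top_le_iff.1 fun _ _ => mem_truncSub.2 fun _ => trivial

/-- The degree `n` part of a subspace `X` of `T_N(W)`, as a subspace of `G_n(W)`. In the degrees
`n > N`, which `T_N(W)` does not see, it is all of `G_n(W)`. -/
def degreePart (X : Submodule ℂ (upTo (fun n => S.GSub 𝔇 n) N)) (n : ℕ) : Submodule ℂ W :=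
  (⨅ hn : n ≤ N, X.comap (lofUpTo (fun n => S.GSub 𝔇 n) hn)).map (S.GSub 𝔇 n).subtype

section degreePart

variable {X : Submodule ℂ (upTo (fun n => S.GSub 𝔇 n) N)}

theorem degreePart_le_GSub (n : ℕ) : degreePart X n ≤ S.GSub 𝔇 n := Submodule.map_subtype_le _ _

theorem coe_mem_degreePart {n : ℕ} {y : S.GSub 𝔇 n} :
    (y : W) ∈ degreePart X n ↔ ∀ hn : n ≤ N, lofUpTo (fun n => S.GSub 𝔇 n) hn y ∈ X := by
  rw [degreePart, ← Submodule.subtype_apply, ← SetLike.mem_coe, Submodule.map_coe,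
    (S.GSub 𝔇 n).injective_subtype.mem_set_image, SetLike.mem_coe, Submodule.mem_iInf]
  rfl

theorem mem_of_component_mem_degreePart {x : upTo (fun n => S.GSub 𝔇 n) N}
    (h : ∀ n, (x.1 n : W) ∈ degreePart X n) : x ∈ X :=
  mem_of_lofUpTo_component_mem fun n => coe_mem_degreePart.1 (h n)

variable (hX : (S.TN 𝔇 N).IsGradedSubmodule X)
include hX

theorem L0_mem_degreePart {n : ℕ} {w : W} (hw : w ∈ degreePart X n) :
    S.L0 w ∈ degreePart X n := by
  lift w to S.GSub 𝔇 n using degreePart_le_GSub n hw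
  refine coe_mem_degreePart (y := S.L0.restrict (S.L0_mem_GSub 𝔇 n) w) |>.2 fun hn => ?_
  have L0_mem := hX.L0_mem _ (coe_mem_degreePart.1 hw hn)
  rwa [TN, truncData_L0_lofUpTo] at L0_mem

theorem Lm1_mem_degreePart {n : ℕ} {w : W} (hw : w ∈ degreePart X n) :
    S.Lm1 w ∈ degreePart X (n + 1) := by
  lift w to S.GSub 𝔇 n using degreePart_le_GSub n hw
  refine coe_mem_degreePart (y := S.Lm1.restrict (S.Lm1_mem_GSub 𝔇 n) w) |>.2 fun hn => ?_
  have Lm1_mem := hX.Lm1_mem _ (coe_mem_degreePart.1 hw (Nat.le_of_succ_le hn))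
  rwa [TN, truncData_Lm1_lofUpTo hn] at Lm1_mem

theorem Lm1_pow_mem_degreePart {n : ℕ} {w : W} (hw : w ∈ degreePart X n) (j : ℕ) :
    (S.Lm1 ^ j) w ∈ degreePart X (n + j) := by
  induction j with
  | zero => exact hw
  | succ j ih =>
    rw [pow_succ', Module.End.mul_apply]
    exact Lm1_mem_degreePart hX ih

theorem opShift_mem_degreePart {l : ℕ} (hl : l ≤ N) {w : W} (hw : w ∈ degreePart X l) (k : ℕ)
    (v : V) : S.opShift ((k : ℤ) - l) v w ∈ degreePart X k := by
  lift w to S.GSub 𝔇 l using degreePart_le_GSub l hw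
  refine coe_mem_degreePart (y := S.GSubAct 𝔇 k l v w) |>.2 fun hk => ?_
  have theta_mem := hX.theta_mem (elemN hk hl v) _ (coe_mem_degreePart.1 hw hl)
  rwa [TN, truncData_elem_lofUpTo] at theta_mem

theorem Lm1_pow_opShift_mem_iSup_degreePart {a : W} (ha : a ∈ degreePart X 0) (j : ℕ) (s : ℤ)
    (v : V) : (S.Lm1 ^ j) (S.opShift s v a) ∈ ⨆ n, degreePart X n := by
  rcases lt_or_ge s 0 with hs | hs
  · have mem_Omega : a ∈ S.Omega 0 := S.GSub_le_Omega 𝔇 0 (degreePart_le_GSub 0 ha)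
    rw [S.opShift_eq_zero_of_mem_Omega (by simpa using hs) mem_Omega, map_zero]
    exact Submodule.zero_mem _
  · lift s to ℕ using hs
    have opShift_mem := opShift_mem_degreePart hX (Nat.zero_le N) ha s v
    rw [Nat.cast_zero, sub_zero] at opShift_mem
    exact Submodule.mem_iSup_of_mem (s + j) (Lm1_pow_mem_degreePart hX opShift_mem j)

end degreePart

variable (S 𝔇 N) in
theorem iSup_TNSub : ⨆ P : 𝔇, S.TNSub 𝔇 N P = ⊤ := by
  refine top_le_iff.1 fun x _ => mem_of_component_mem_degreePart fun n => ?_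
  suffices S.GSub 𝔇 n ≤ degreePart (⨆ P : 𝔇, S.TNSub 𝔇 N P) n from this (x.1 n).2
  refine iSup₂_le fun P hP => iSup₂_le fun h hh y hy => ?_
  exact coe_mem_degreePart (y := ⟨y, hh.inf_le_GSub hP n hy⟩) |>.2 fun hn =>
    Submodule.mem_iSup_of_mem ⟨P, hP⟩ ((lofUpTo_mem_truncSub hn).2 hy.1)

namespace IsDecomposition

variable (h𝔇 : S.IsDecomposition 𝔇)
include h𝔇

theorem TNSub_ne_bot {P : Submodule ℂ W} (hP : P ∈ 𝔇) : S.TNSub 𝔇 N P ≠ ⊥ := by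
  obtain ⟨h, hh⟩ := h𝔇.exists_isLowestWeight ⟨P, hP⟩
  obtain ⟨x, hx, hx0⟩ := (Submodule.ne_bot_iff _).1 hh.2.2
  have mem_GSub : x ∈ S.GSub 𝔇 0 := hh.inf_le_GSub hP 0 (by simpa using hx)
  refine (Submodule.ne_bot_iff _).2 ⟨lofUpTo (fun n => S.GSub 𝔇 n) (Nat.zero_le N) ⟨x, mem_GSub⟩,
    (lofUpTo_mem_truncSub _).2 hx.1, fun heq => hx0 ?_⟩
  have component_eq := lofUpTo_apply_self (G := fun n => S.GSub 𝔇 n) (Nat.zero_le N) ⟨x, mem_GSub⟩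
  rw [heq] at component_eq
  exact congrArg Subtype.val component_eq.symm

theorem iSupIndep_TNSub : iSupIndep fun P : 𝔇 => S.TNSub 𝔇 N P := by
  intro P
  rw [Submodule.disjoint_def]
  intro x hx hx'
  refine (Submodule.mem_bot ℂ).1 (mem_of_lofUpTo_component_mem fun n hn => ?_)
  have component_mem : (x.1 n : W) ∈ ⨆ (Q : 𝔇) (_ : Q ≠ P), (Q : Submodule ℂ W) := by
    suffices (⨆ (Q : 𝔇) (_ : Q ≠ P), S.TNSub 𝔇 N Q) ≤
      (⨆ (Q : 𝔇) (_ : Q ≠ P), (Q : Submodule ℂ W)).comap ((S.GSub 𝔇 n).subtype ∘ₗ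
        DirectSum.component ℂ ℕ (fun n => S.GSub 𝔇 n) n ∘ₗ (upTo _ N).subtype) from this hx'
    exact iSup₂_le fun Q hQ y hy => Submodule.mem_iSup_of_mem Q
      (Submodule.mem_iSup_of_mem hQ (mem_truncSub.1 hy n))
  have component_eq_zero : x.1 n = 0 := Subtype.ext
    (Submodule.disjoint_def.1 ((sSupIndep_iff _).1 h𝔇.2.1 P) _ (mem_truncSub.1 hx n) component_mem)
  rw [component_eq_zero, map_zero]
  exact Submodule.zero_mem _

theorem iSup_degreePart_inf_GSub_le (X : Submodule ℂ (upTo (fun n => S.GSub 𝔇 n) N)) (n : ℕ) :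
    (⨆ m, degreePart X m) ⊓ S.GSub 𝔇 n ≤ degreePart X n := by
  rintro w ⟨hw, hwn⟩
  rw [← internalProj_of_mem h𝔇.isInternal_GSub hwn]
  suffices ⨆ m, degreePart X m ≤ (degreePart X n).comap (internalProj h𝔇.isInternal_GSub n)
    from this hw
  refine iSup_le fun m x hx => ?_
  rw [Submodule.mem_comap]
  rcases eq_or_ne m n with rfl | hmn
  · rwa [internalProj_of_mem h𝔇.isInternal_GSub (degreePart_le_GSub m hx)]
  · rw [internalProj_of_mem_ne h𝔇.isInternal_GSub hmn (degreePart_le_GSub m hx)]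
    exact Submodule.zero_mem _

section

variable {X : Submodule ℂ (upTo (fun n => S.GSub 𝔇 n) N)}
  (hX : (S.TN 𝔇 N).IsGradedSubmodule X)
include hX

theorem degreePart_zero_ne_bot (hne : X ≠ ⊥) : degreePart X 0 ≠ ⊥ := by
  intro hbot
  refine hne (le_bot_iff.1 fun x hx => ?_)
  have hTN := h𝔇.TN_isGradedModule N
  rw [hX.graded] at hx
  suffices ⨆ n, X ⊓ (S.TN 𝔇 N).gr n ≤ ⊥ from this hx
  refine iSup_le fun l => ?_
  rcases lt_or_ge N l with hl | hl
  · rw [hTN.gr_eq_bot l hl, inf_bot_eq]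
  rintro w ⟨hwX, hwl⟩
  refine hTN.nondegenerate l hl w hwl fun v => ?_
  obtain ⟨y, hy⟩ := exists_lofUpTo_of_mem_gr (Nat.zero_le N)
    (hTN.elem_mem 0 l (Nat.zero_le N) hl v w hwl)
  have y_mem : (y : W) ∈ degreePart X 0 :=
    coe_mem_degreePart.2 fun _ => hy ▸ hX.theta_mem (elemN (Nat.zero_le N) hl v) w hwX
  rw [hbot, Submodule.mem_bot, Submodule.coe_eq_zero] at y_mem
  rw [← hy, y_mem, map_zero]

-- The lowest degree part of `X` generates `P`.
theorem TNSub_le {P : Submodule ℂ W} (hP : P ∈ 𝔇) (hXP : X ≤ S.TNSub 𝔇 N P) (hne : X ≠ ⊥) :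
    S.TNSub 𝔇 N P ≤ X := by
  have lowest_le : degreePart X 0 ≤ P := fun w hw => by
    lift w to S.GSub 𝔇 0 using degreePart_le_GSub 0 hw
    exact (lofUpTo_mem_truncSub _).1 (hXP (coe_mem_degreePart.1 hw (Nat.zero_le N)))
  have generated_eq : S.generated (degreePart X 0) = P :=
    S.generated_eq_of_isIrreducibleSub (h𝔇.1 P hP) lowest_le (fun _ => L0_mem_degreePart hX)
      (h𝔇.degreePart_zero_ne_bot hX hne)
  have le_iSup_degreePart : P ≤ ⨆ n, degreePart X n := generated_eq.ge.trans
    (S.generated_le fun _ ha j s v => Lm1_pow_opShift_mem_iSup_degreePart hX ha j s v)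
  exact fun x hx => mem_of_component_mem_degreePart fun n =>
    h𝔇.iSup_degreePart_inf_GSub_le X n ⟨le_iSup_degreePart (mem_truncSub.1 hx n), (x.1 n).2⟩

end

theorem TNSub_isIrreducibleSub {P : Submodule ℂ W} (hP : P ∈ 𝔇) :
    (S.TN 𝔇 N).IsIrreducibleSub (S.TNSub 𝔇 N P) :=
  ⟨TNSub_isGradedSubmodule (h𝔇.isSubmodule hP), h𝔇.TNSub_ne_bot hP, fun _ hXP hX =>
    or_iff_not_imp_left.2 fun hne => le_antisymm hXP (h𝔇.TNSub_le hX hP hXP hne)⟩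

theorem TN_isCompletelyReducible (N : ℕ) : (S.TN 𝔇 N).IsCompletelyReducible := by
  refine ⟨Set.range fun P : 𝔇 => S.TNSub 𝔇 N P, ?_, h𝔇.iSupIndep_TNSub.sSupIndep_range, ?_⟩
  · rintro _ ⟨P, rfl⟩
    exact h𝔇.TNSub_isIrreducibleSub P.2
  · rw [sSup_range, S.iSup_TNSub 𝔇 N]

end IsDecomposition

theorem IsIrreducible.TN_isIrreducible (h : S.IsIrreducible) (N : ℕ) :
    (S.TN {⊤} N).IsIrreducible := by
  rw [GradedData.IsIrreducible, ← TNSub_top]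
  exact h.isDecomposition.TNSub_isIrreducibleSub rfl

end LBGModule

end

theorem proposition5p3 {V W : Type u} [AddCommGroup V] [Module ℂ V]
    [GradingRestrictedVertexAlgebra V] [AddCommGroup W] [Module ℂ W] (S : LBGModule V W) (N : ℕ) :
    (S.IsIrreducible →
      DirectSum.IsInternal (S.GSub {⊤}) ∧
      (S.GrN N).IsGradedModule ∧ (S.TN {⊤} N).IsGradedModule ∧
      (S.GrN N).Equivalent (S.TN {⊤} N) ∧
      (S.GrN N).IsIrreducible) ∧
    (S.IsCompletelyReducible →
      (S.GrN N).IsGradedModule ∧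
      (∀ 𝔇 : Set (Submodule ℂ W), S.IsDecomposition 𝔇 →
        DirectSum.IsInternal (S.GSub 𝔇) ∧
        (S.TN 𝔇 N).IsGradedModule ∧ (S.GrN N).Equivalent (S.TN 𝔇 N)) ∧
      (S.GrN N).IsCompletelyReducible) := by
  refine ⟨fun h => ?_, fun h => ⟨S.GrN_isGradedModule N, fun 𝔇 h𝔇 => ?_, ?_⟩⟩
  · have equivalence := h.isDecomposition.isEquivalence_TN_GrN N
    exact ⟨h.isDecomposition.isInternal_GSub, S.GrN_isGradedModule N,
      h.isDecomposition.TN_isGradedModule N, equivalence.symm.equivalent,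
      equivalence.isIrreducible (h.TN_isIrreducible N)⟩
  · exact ⟨h𝔇.isInternal_GSub, h𝔇.TN_isGradedModule N,
      (h𝔇.isEquivalence_TN_GrN N).symm.equivalent⟩
  · obtain ⟨𝔇, h𝔇⟩ := h
    exact (h𝔇.isEquivalence_TN_GrN N).isCompletelyReducible (h𝔇.TN_isCompletelyReducible N)
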